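/- Fix a finite, functionally complete basis $B$ of Boolean operations of fan-in at most two (a gate reads two earlier wires; an operation of smaller arity ignores an argument). A circuit over $B$ on $n$ inputs is a topologically ordered list of gates with operations in $B$, each reading inputs or earlier gates, together with an output wire (an input or a gate); its size $|C|$ is its number of gates. Functional completeness means that every Boolean function of $n\ge 1$ variables is computed by some circuit over $B$. The truth table of $f:\{0,1\}^n\to\{0,1\}$ is the string of length $2^n$ that lists the values of $f$ in the lexicographic order of the inputs. The Minimum Circuit Size Problem is the language $$\mathrm{MCSP}_B=\{\langle T,s\rangle : T\in\{0,1\}^{2^n}\text{ for some } n,\ s\in\mathbb N,\text{ and some circuit } C \text{ over } B \text{ with } |C|\le s \text{ has truth table } T\},$$ where $\langle T,s\rangle$ is a bit string of length $2|T|+O(\log (s+2))$ (with $s$ in binary). **Lemma.** $\mathrm{MCSP}_B\in \mathrm{NP}$. More precisely, circuits serve as certificates (with a fixed encoding of circuits as bit strings, of length polynomial in $n+|C|$): 1. the relation "$w$ encodes a circuit $C$ over $B$ with $|C|\le s$ whose truth table is $T$", between strings $x=\langle T,s\rangle$ and $w$, is decided by a Turing machine in time polynomial in $|x|+|w|$,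 and there is a polynomial $p_0$ such that $x\in\mathrm{MCSP}_B$ if and only if some $w$ with $|w|\le p_0(|x|)$ stands in this relation to $x$; 2. there is a polynomial $p$ such that every $\langle T,s\rangle\in\mathrm{MCSP}_B$ has such a certificate $w$ with $|w|\le p(|T|)$, where $|T|=2^n$. Consequently the verification of such a certificate takes time polynomial in $|T|+\log (s+2)$; in particular, it takes time polynomial in $|T|=2^n$ whenever $\log (s+2)$ is bounded by a polynomial in $|T|$. -/

import Mathlib

namespace MinCircuit

/-! ### Polynomial-time decidable relations and NP -/

/-- The pair `(x, w)` of bit strings, written as one input string with a separator symbol `none`. -/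
def encodePair (p : List Bool × List Bool) : List (Option Bool) :=
  p.1.map some ++ none :: p.2.map some

open Classical in
/-- A binary relation on bit strings is decidable in polynomial time: some (multi-stack) Turing
machine, on every input `(x, w)`, halts within `q (|(x, w)|)` steps for a fixed polynomial `q` and
outputs the truth value of `R x w`. -/
def PolyTimeDecidable (R : List Bool → List Bool → Prop) : Prop :=
  Nonempty (Turing.TM2ComputableInPolyTime encodePair Computability.encodeBool
    (fun p : List Bool × List Bool => decide (R p.1 p.2)))

/-- `R` is a polynomial-time verifier for the language `L`: it is decidable in polynomial time,
and the members of `L` are the strings that have a certificate of polynomial length. -/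
def IsPolyTimeVerifier (R : List Bool → List Bool → Prop) (L : Language Bool) : Prop :=
  PolyTimeDecidable R ∧
    ∃ p : Polynomial ℕ, ∀ x : List Bool,
      x ∈ L ↔ ∃ w : List Bool, w.length ≤ p.eval x.length ∧ R x w

/-- The class NP of languages over the alphabet `{0, 1}`. -/
def NP : Set (Language Bool) :=
  {L | ∃ R : List Bool → List Bool → Prop, IsPolyTimeVerifier R L}

/-! ### Boolean circuits -/

/-- A gate with a Boolean operation and the names of the two wires it reads. An operation of
smaller arity, such as negation, is a binary operation that ignores an argument. -/
structure Gate where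
  op : Bool → Bool → Bool
  left : ℕ
  right : ℕ

/-- A Boolean circuit over the basis `B` with `n` inputs, its gates listed in topological order.
Wires `0, …, n - 1` are the inputs, and wire `n + k` is the output of gate number `k`, which may
read any earlier wire. The output of the circuit is one of the wires. -/
structure Circuit (B : Set (Bool → Bool → Bool)) (n : ℕ) where
  gates : List Gate
  out : ℕ
  op_mem : ∀ g ∈ gates, g.op ∈ B
  left_lt : ∀ (k : ℕ) (hk : k < gates.length), gates[k].left < n + k
  right_lt : ∀ (k : ℕ) (hk : k < gates.length), gates[k].right < n + k
  out_lt : out < n + gates.length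

namespace Circuit

variable {B : Set (Bool → Bool → Bool)} {n : ℕ}

/-- The size of a circuit is its number of gates. -/
def size (C : Circuit B n) : ℕ := C.gates.length

/-- The values of all wires, in order, on the input `x`. The default value in `getD` is never
used, because every wire that is read is present. -/
def wires (C : Circuit B n) (x : Fin n → Bool) : List Bool :=
  C.gates.foldl (fun v g => v ++ [g.op (v.getD g.left false) (v.getD g.right false)])
    (List.ofFn x)

/-- The Boolean function that the circuit computes. -/
def eval (C : Circuit B n) (x : Fin n → Bool) : Bool := (C.wires x).getD C.out false

end Circuit

/-- The basis `B` is functionally complete: every Boolean function of at least one variable is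
computed by some circuit over `B`. -/
def FunctionallyComplete (B : Set (Bool → Bool → Bool)) : Prop :=
  ∀ n : ℕ, 1 ≤ n → ∀ f : (Fin n → Bool) → Bool, ∃ C : Circuit B n, C.eval = f

/-- The `i`-th input of length `n` in lexicographic order (the first coordinate is the most
significant bit of `i`). -/
def lexInput (n i : ℕ) : Fin n → Bool := fun j => i.testBit (n - 1 - j)

/-- The truth table of `f`: the bit string of length `2 ^ n` that lists the values of `f` on all
inputs in lexicographic order. -/
def truthTable {n : ℕ} (f : (Fin n → Bool) → Bool) : List Bool :=
  List.ofFn (fun i : Fin (2 ^ n) => f (lexInput n i))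

/-! ### Encodings by bit strings -/

/-- The bit string `⟨T, s⟩`: each bit `b` of `T` is written as `1b`, then follow a `0` and the
binary digits of `s`, least significant first and without redundant zeros. -/
def encodeInstance (T : List Bool) (s : ℕ) : List Bool :=
  T.flatMap (fun b => [true, b]) ++ false :: s.bits

/-- `i` in unary, with an end mark. -/
def unary (i : ℕ) : List Bool := List.replicate i true ++ [false]

/-- A gate is written as a `1`, the four values of its operation, and its two wires. -/
def Gate.encode (g : Gate) : List Bool :=
  [true, g.op false false, g.op false true, g.op true false, g.op true true] ++
    unary g.left ++ unary g.right

/-- A circuit is written as the list of its gates, a `0`, and its output wire. -/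
def Circuit.encode {B : Set (Bool → Bool → Bool)} {n : ℕ} (C : Circuit B n) : List Bool :=
  C.gates.flatMap Gate.encode ++ false :: unary C.out

/-! ### The Minimum Circuit Size Problem -/

/-- The Minimum Circuit Size Problem over the basis `B`: the strings `⟨T, s⟩` such that `T` is a
truth table (on some number `n` of variables) of a circuit over `B` with at most `s` gates. -/
def MCSP (B : Set (Bool → Bool → Bool)) : Language Bool :=
  {x | ∃ (T : List Bool) (s : ℕ), x = encodeInstance T s ∧
    ∃ (n : ℕ) (C : Circuit B n), C.size ≤ s ∧ truthTable C.eval = T}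

/-- The string `w` is (the code of) a circuit over `B` that has at most `s` gates and the truth
table `T`, where `x = ⟨T, s⟩`. -/
def CircuitCertifies (B : Set (Bool → Bool → Bool)) (x w : List Bool) : Prop :=
  ∃ (T : List Bool) (s : ℕ), x = encodeInstance T s ∧
    ∃ (n : ℕ) (C : Circuit B n), w = C.encode ∧ C.size ≤ s ∧ truthTable C.eval = T

end MinCircuit

/-!
The certificates are the circuits themselves, in the encoding `Circuit.encode`. Two facts are to be
shown: the relation `CircuitCertifies B` is decided by a polynomial-time Turing machine, and the
members of `MCSP B` have certificates that are short in terms of the truth table.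

*The machine.* Structured programs over stacks of bits (`Prog`), whose cost `Runs` counts the
evaluations of loop conditions, translate to the multi-stack machines of Mathlib
(`Runs.exists_iterate`, `Prog.computableInPolyTime`): a machine step ends exactly at the jump to a
loop. It remains to write the verifier as such a program. Its input-output behaviour is that of a
function on lists (`rejects`). The input is parsed, the length of the truth table is compared with
the powers of two, and for each entry of the truth table the string `w` is read once by an evaluator
(`Eval.step`). The evaluator holds the values of all wires known so far as two stacks, and moves one
entry from one to the other for each unit of a wire name that it reads. It also adds one for each
gate to the complement of the binary digits of `s`, so that an overflow occurs as soon as there are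
more than `s` gates. If the evaluator ends without an error, then what it has read is the code of a
circuit of size at most `s` (`exists_circuit_of_foldl`, by an invariant that describes the part of
the code read so far); conversely, it ends without an error on each such code, with the value of the
circuit (`foldl_circuit_encode`). Hence one successful row yields the circuit, and the others yield
its truth table (`rejects_parse_eq_false_iff`). Each stack stays linear in the length of the input,
so a cubic number of loop tests suffices (`runs_verifier`).

*Short certificates.* A circuit within the bound `s` may have far more gates than the truth table
has entries, since `s` is written in binary. It is then replaced by a smaller one for the same
function: as `B` is functionally complete, each binary operation on two wires can be added to a list
of gates at the cost of at most `c` gates (`exists_binary_cost`), and the disjunctive normal form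
gives a circuit with `O(n 2 ^ n)` gates (`exists_circuit_size_le`).
-/

namespace MinCircuit

/-! ### Structured stack programs and their translation to Turing machines -/

section Programs

/-- Structured programs that work on an input stack over the alphabet `Option Bool`, on stacks of
bits indexed by `K`, and on a register with values in `σ`. The commands pop the input stack, push
to and pop from a work stack, change the register, and combine programs by sequence, case
distinction, and iteration as long as `c` holds. -/
inductive Prog (K σ : Type) : Type
  | read (f : σ → Option (Option Bool) → σ) : Prog K σ
  | push (k : K) (f : σ → Bool) : Prog K σ
  | pop (k : K) (f : σ → Option Bool → σ) : Prog K σ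
  | load (f : σ → σ) : Prog K σ
  | seq (p q : Prog K σ) : Prog K σ
  | ite (c : σ → Bool) (p q : Prog K σ) : Prog K σ
  | loop (c : σ → Bool) (p : Prog K σ) : Prog K σ

/-- The stack alphabets: the stack `none` holds the input, all other stacks hold bits. -/
abbrev Alphabet (K : Type) : Option K → Type
  | none => Option Bool
  | some _ => Bool

/-- The memory of a structured program. -/
@[ext] structure Memory (K σ : Type) where
  reg : σ
  inp : List (Option Bool)
  stk : K → List Bool

variable {K σ : Type}

/-- All stacks of the memory, as a family for the stack machine model. -/
def Memory.stacks (s : Memory K σ) : ∀ k : Option K, List (Alphabet K k)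
  | none => s.inp
  | some k => s.stk k

namespace Prog

/-- The labels of a program: one for each of its loops. -/
def Label : Prog K σ → Type
  | seq p q => Label p ⊕ Label q
  | ite _ p q => Label p ⊕ Label q
  | loop _ p => Option (Label p)
  | _ => Empty

noncomputable instance Label.fintype : ∀ p : Prog K σ, Fintype (Label p)
  | read _ => inferInstanceAs (Fintype Empty)
  | push _ _ => inferInstanceAs (Fintype Empty)
  | pop _ _ => inferInstanceAs (Fintype Empty)
  | load _ => inferInstanceAs (Fintype Empty)
  | seq p q =>
    haveI := Label.fintype p
    haveI := Label.fintype q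
    inferInstanceAs (Fintype (Label p ⊕ Label q))
  | ite _ p q =>
    haveI := Label.fintype p
    haveI := Label.fintype q
    inferInstanceAs (Fintype (Label p ⊕ Label q))
  | loop _ p =>
    haveI := Label.fintype p
    inferInstanceAs (Fintype (Option (Label p)))

/-- The statement that executes `p`, with its labels embedded by `e`, and goes on with `q`. -/
def code {Λ : Type} : (p : Prog K σ) → (Label p → Λ) → Turing.TM2.Stmt (Alphabet K) Λ σ →
    Turing.TM2.Stmt (Alphabet K) Λ σ
  | read f, _, q => .pop none f q
  | push k f, _, q => .push (some k) f q
  | pop k f, _, q => .pop (some k) f q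
  | load f, _, q => .load f q
  | seq p₁ p₂, e, q => code p₁ (fun l => e (Sum.inl l)) (code p₂ (fun l => e (Sum.inr l)) q)
  | ite c p₁ p₂, e, q =>
    .branch c (code p₁ (fun l => e (Sum.inl l)) q) (code p₂ (fun l => e (Sum.inr l)) q)
  | loop _ _, e, _ => .goto fun _ => e none

/-- The statement at each label of `p`, when `p` is followed by `q`. A loop jumps to its own label
at the end of its body. -/
def body {Λ : Type} : (p : Prog K σ) → (Label p → Λ) → Turing.TM2.Stmt (Alphabet K) Λ σ →
    Label p → Turing.TM2.Stmt (Alphabet K) Λ σ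
  | seq p₁ p₂, e, q, l => match l with
    | Sum.inl l => body p₁ (fun l => e (Sum.inl l)) (code p₂ (fun l => e (Sum.inr l)) q) l
    | Sum.inr l => body p₂ (fun l => e (Sum.inr l)) q l
  | ite _ p₁ p₂, e, q, l => match l with
    | Sum.inl l => body p₁ (fun l => e (Sum.inl l)) q l
    | Sum.inr l => body p₂ (fun l => e (Sum.inr l)) q l
  | loop c p, e, q, l => match l with
    | none => .branch c (code p (fun l => e (some l)) (.goto fun _ => e none)) q
    | some l => body p (fun l => e (some l)) (.goto fun _ => e none) l
  | read _, _, q, _ => q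
  | push _ _, _, q, _ => q
  | pop _ _, _, q, _ => q
  | load _, _, q, _ => q

/-- The effect of a program without loops; a loop is treated as if its body were never entered. -/
def run [DecidableEq K] : Prog K σ → Memory K σ → Memory K σ
  | read f, s => ⟨f s.reg s.inp.head?, s.inp.tail, s.stk⟩
  | push k f, s => ⟨s.reg, s.inp, Function.update s.stk k (f s.reg :: s.stk k)⟩
  | pop k f, s => ⟨f s.reg (s.stk k).head?, s.inp, Function.update s.stk k (s.stk k).tail⟩
  | load f, s => ⟨f s.reg, s.inp, s.stk⟩
  | seq p q, s => run q (run p s)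
  | ite c p q, s => cond (c s.reg) (run p s) (run q s)
  | loop _ _, s => s

/-- The program has no loops. -/
def flat : Prog K σ → Bool
  | seq p q => flat p && flat q
  | ite _ p q => flat p && flat q
  | loop _ _ => false
  | _ => true

end Prog

/-- `Runs p s s' t`: started in `s`, the program `p` ends in `s'`, after at most `t` evaluations of
loop conditions. -/
inductive Runs [DecidableEq K] :
    Prog K σ → Memory K σ → Memory K σ → ℕ → Prop
  | flat {p : Prog K σ} (s) (h : p.flat = true) : Runs p s (p.run s) 0
  | seq {p q : Prog K σ} {s s' s'' t t'} (h : Runs p s s' t) (h' : Runs q s' s'' t') :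
      Runs (.seq p q) s s'' (t + t')
  | ite_true {c : σ → Bool} {p q : Prog K σ} {s s' t} (hc : c s.reg = true) (h : Runs p s s' t) :
      Runs (.ite c p q) s s' t
  | ite_false {c : σ → Bool} {p q : Prog K σ} {s s' t} (hc : c s.reg = false) (h : Runs q s s' t) :
      Runs (.ite c p q) s s' t
  | loop_done {c : σ → Bool} {p : Prog K σ} {s} (hc : c s.reg = false) : Runs (.loop c p) s s 1
  | loop_next {c : σ → Bool} {p : Prog K σ} {s s' s'' t t'} (hc : c s.reg = true)
      (h : Runs p s s' t) (h' : Runs (.loop c p) s' s'' t') : Runs (.loop c p) s s'' (t + t' + 1)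
  | mono {p : Prog K σ} {s s' t t'} (h : Runs p s s' t) (ht : t ≤ t') : Runs p s s' t'

section Translation

variable [DecidableEq K]

lemma Memory.update_none (s : Memory K σ) (l : List (Option Bool)) :
    Function.update s.stacks none l = (⟨s.reg, l, s.stk⟩ : Memory K σ).stacks := by
  funext k; cases k <;> rfl

lemma Memory.update_some (s : Memory K σ) (k : K) (l : List Bool) :
    Function.update s.stacks (some k) l =
      (⟨s.reg, s.inp, Function.update s.stk k l⟩ : Memory K σ).stacks := by
  funext k'
  cases k' with
  | none => rfl
  | some k' =>
    by_cases h : k' = k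
    · subst h; simp [Memory.stacks]
    · simp [Memory.stacks, h]

open Turing in
lemma stepAux_code_of_flat {Λ : Type} (p : Prog K σ) (hp : p.flat = true) (s : Memory K σ)
    (e : p.Label → Λ) (q : TM2.Stmt (Alphabet K) Λ σ) :
    TM2.stepAux (p.code e q) s.reg s.stacks =
      TM2.stepAux q (p.run s).reg (p.run s).stacks := by
  induction p generalizing s q with
  | read f => simp only [Prog.code, TM2.stepAux, Memory.update_none]; rfl
  | push k f => simp only [Prog.code, TM2.stepAux, Memory.update_some]; rfl
  | pop k f => simp only [Prog.code, TM2.stepAux, Memory.update_some]; rfl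
  | load f => rfl
  | seq p₁ p₂ ih₁ ih₂ =>
    simp only [Prog.flat, Bool.and_eq_true] at hp
    simp only [Prog.code, Prog.run]
    rw [ih₁ hp.1, ih₂ hp.2]
  | ite c p₁ p₂ ih₁ ih₂ =>
    simp only [Prog.flat, Bool.and_eq_true] at hp
    simp only [Prog.code, Prog.run, TM2.stepAux]
    cases c s.reg
    · exact ih₂ hp.2 ..
    · exact ih₁ hp.1 ..
  | loop c p ih => simp [Prog.flat] at hp

open Turing in
/-- A run with cost `t` takes at most `t` steps of any machine whose program contains the
translation: only the jump to a loop label ends a step of the machine. -/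
theorem Runs.exists_iterate {p : Prog K σ} {s s' : Memory K σ} {t : ℕ} (h : Runs p s s' t)
    {Λ : Type} (M : Λ → TM2.Stmt (Alphabet K) Λ σ) (e : p.Label → Λ)
    (q : TM2.Stmt (Alphabet K) Λ σ) (hM : ∀ l, M (e l) = p.body e q l) :
    ∃ t' ≤ t, (flip bind (TM2.step M))^[t'] (some (TM2.stepAux (p.code e q) s.reg s.stacks)) =
      some (TM2.stepAux q s'.reg s'.stacks) := by
  induction h generalizing q with
  | flat s h => exact ⟨0, le_rfl, by simp [stepAux_code_of_flat _ h]⟩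
  | seq _ _ ih ih' =>
    obtain ⟨t₁, ht₁, h₁⟩ := ih _ _ fun l => hM (Sum.inl l)
    obtain ⟨t₂, ht₂, h₂⟩ := ih' _ _ fun l => hM (Sum.inr l)
    refine ⟨t₂ + t₁, by omega, ?_⟩
    rw [Function.iterate_add_apply]
    simp only [Prog.code]
    rw [h₁, h₂]
  | ite_true hc _ ih =>
    obtain ⟨t₁, ht₁, h₁⟩ := ih _ _ fun l => hM (Sum.inl l)
    refine ⟨t₁, ht₁, ?_⟩
    simpa only [Prog.code, TM2.stepAux, hc, cond_true] using h₁
  | ite_false hc _ ih =>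
    obtain ⟨t₁, ht₁, h₁⟩ := ih _ _ fun l => hM (Sum.inr l)
    refine ⟨t₁, ht₁, ?_⟩
    simpa only [Prog.code, TM2.stepAux, hc, cond_false] using h₁
  | loop_done hc =>
    refine ⟨1, le_rfl, ?_⟩
    have := hM none
    simp only [Prog.body] at this
    simp [Prog.code, flip, this, hc]
  | loop_next hc _ _ ih ih' =>
    obtain ⟨t₁, ht₁, h₁⟩ := ih (fun l => e (some l)) (.goto fun _ => e none)
      fun l => hM (some l)
    obtain ⟨t₂, ht₂, h₂⟩ := ih' e q hM
    refine ⟨t₂ + t₁ + 1, by omega, ?_⟩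
    have := hM none
    simp only [Prog.body] at this
    rw [Function.iterate_add_apply, Function.iterate_one, Function.iterate_add_apply]
    simp only [Prog.code, flip, Option.bind_eq_bind, Option.bind_some, TM2.stepAux, TM2.step,
      this, hc, cond_true] at h₁ h₂ ⊢
    rw [h₁, h₂]
  | mono _ ht ih =>
    obtain ⟨t₁, ht₁, h₁⟩ := ih e q hM
    exact ⟨t₁, ht₁.trans ht, h₁⟩

/-- The machine that runs `p` and halts, with output stack `k`. Its labels are those of `p` and a
label `none` for the beginning. -/
noncomputable def Prog.machine [Fintype K] [Fintype σ] (p : Prog K σ) (k : K) (v : σ) :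
    Turing.FinTM2 where
  K := Option K
  k₀ := none
  k₁ := some k
  Γ := Alphabet K
  Λ := Option p.Label
  main := none
  σ := σ
  initialState := v
  Γk₀Fin := inferInstanceAs (Fintype (Option Bool))
  m
    | none => p.code some .halt
    | some l => p.body some .halt l

/-- A structured program that, started on the code of `a` with empty work stacks, ends within a
polynomial number of loop tests with the code of `f a` as its only stack contents and its register
restored, gives a polynomial-time Turing machine for `f`. -/
theorem Prog.computableInPolyTime [Fintype K] [Fintype σ] (p : Prog K σ) (k : K) (v : σ)
    {α β : Type} (ea : α → List (Option Bool)) (eb : β → List Bool) (f : α → β)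
    (time : Polynomial ℕ)
    (h : ∀ a, Runs p ⟨v, ea a, fun _ => []⟩ ⟨v, [], Function.update (fun _ => []) k (eb (f a))⟩
      (time.eval (ea a).length)) :
    Nonempty (Turing.TM2ComputableInPolyTime ea eb f) := by
  refine ⟨{ tm := p.machine k v, inputAlphabet := Equiv.refl _, outputAlphabet := Equiv.refl _,
            time := time + 1, outputsFun := fun a => ?_ }⟩
  have hrun := (h a).exists_iterate (p.machine k v).m some .halt (fun l => rfl)
  refine Classical.choice ?_
  obtain ⟨t, ht, hrun⟩ := hrun
  refine ⟨⟨⟨t + 1, ?_⟩, by simpa using ht⟩⟩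
  rw [Function.iterate_add_apply]
  have hin : (Turing.initList (p.machine k v) ((ea a).map (Equiv.refl (Option Bool)).invFun)) =
      ⟨some none, v, (⟨v, ea a, fun _ => []⟩ : Memory K σ).stacks⟩ := by
    simp only [Turing.initList]
    congr 1
    funext j
    cases j with
    | none => simp [Prog.machine, Memory.stacks]; rfl
    | some j => simp [Prog.machine, Memory.stacks]
  have hout : (Turing.haltList (p.machine k v) ((eb (f a)).map (Equiv.refl Bool).invFun)) =
      ⟨none, v, (⟨v, [], Function.update (fun _ => []) k (eb (f a))⟩ :
        Memory K σ).stacks⟩ := by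
    simp only [Turing.haltList]
    congr 1
    funext j
    cases j with
    | none => simp [Prog.machine, Memory.stacks]
    | some j =>
      by_cases hj : j = k
      · subst hj; simp [Prog.machine, Memory.stacks]; rfl
      · simp [Prog.machine, Memory.stacks, hj]
  simp only [Option.map_some]
  erw [hin, hout]
  exact hrun

end Translation

end Programs

/-! ### Binary counters -/

/-- The number whose binary digits are `l`, least significant first. -/
def bitsVal : List Bool → ℕ
  | [] => 0
  | b :: l => b.toNat + 2 * bitsVal l

/-- Add one to a binary number. The list becomes longer only if all of its digits are `1`. -/
def inc : List Bool → List Bool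
  | [] => [true]
  | false :: l => true :: l
  | true :: l => false :: inc l

lemma bitsVal_inc (l : List Bool) : bitsVal (inc l) = bitsVal l + 1 := by
  induction l with
  | nil => rfl
  | cons b l ih => cases b <;> simp [inc, bitsVal, ih] <;> omega

lemma length_inc {l : List Bool} (h : l.all id = false) : (inc l).length = l.length := by
  induction l with
  | nil => simp at h
  | cons b l ih =>
    cases b
    · rfl
    · simp only [List.all_cons, id, Bool.true_and] at h
      simp [inc, ih h]

lemma length_inc_le (l : List Bool) : (inc l).length ≤ l.length + 1 := by
  induction l with
  | nil => simp [inc]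
  | cons b l ih => cases b <;> simp [inc, ih]

lemma bitsVal_lt (l : List Bool) : bitsVal l < 2 ^ l.length := by
  induction l with
  | nil => simp [bitsVal]
  | cons b l ih => cases b <;> simp [bitsVal, pow_succ] <;> omega

lemma bitsVal_of_all {l : List Bool} (h : l.all id = true) : bitsVal l + 1 = 2 ^ l.length := by
  induction l with
  | nil => simp [bitsVal]
  | cons b l ih =>
    simp only [List.all_cons, id, Bool.and_eq_true] at h
    have := ih h.2
    simp only [bitsVal, h.1, List.length_cons, pow_succ, Bool.toNat_true]
    omega

lemma bitsVal_map_not (l : List Bool) :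
    bitsVal (l.map not) + bitsVal l + 1 = 2 ^ l.length := by
  induction l with
  | nil => simp [bitsVal]
  | cons b l ih => cases b <;> simp [bitsVal, pow_succ] <;> omega

lemma bits_two_mul_add (b : Bool) (n : ℕ) (h : n = 0 → b = true) :
    (2 * n + b.toNat).bits = b :: n.bits := by
  have := Nat.bits_append_bit n b h
  rwa [Nat.bit_val] at this

lemma bitsVal_bits (n : ℕ) : bitsVal n.bits = n := by
  induction n using Nat.binaryRec' with
  | zero => simp [bitsVal]
  | bit b n h ih =>
    rw [Nat.bits_append_bit n b h, bitsVal, ih, Nat.bit_val]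
    ring

lemma inc_bits (n : ℕ) : inc n.bits = (n + 1).bits := by
  induction n using Nat.binaryRec' with
  | zero => simp [inc]
  | bit b n h ih =>
    rw [Nat.bits_append_bit n b h, Nat.bit_val]
    cases b
    · exact (bits_two_mul_add true n (fun _ => rfl)).symm
    · have := bits_two_mul_add false (n + 1) (fun h => by omega)
      rw [inc, ih, ← this]
      congr 1

lemma iterate_inc_nil (m : ℕ) : inc^[m] [] = m.bits := by
  induction m with
  | zero => simp
  | succ m ih => rw [Function.iterate_succ_apply', ih, inc_bits]

/-- A digit string is the standard binary representation of a number if its most significant digit,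
if there is one, is `1`. -/
lemma exists_bits_eq (l : List Bool) (h : l.getLast?.getD true = true) : ∃ s : ℕ, s.bits = l := by
  induction l with
  | nil => exact ⟨0, by simp⟩
  | cons b l ih =>
    cases l with
    | nil =>
      simp only [List.getLast?_singleton, Option.getD_some] at h
      subst h
      exact ⟨1, by simp⟩
    | cons c l =>
      obtain ⟨s, hs⟩ := ih (by simpa using h)
      refine ⟨2 * s + b.toNat, ?_⟩
      rw [bits_two_mul_add, hs]
      rintro rfl
      simp at hs

lemma getLast?_bits (s : ℕ) : s.bits.getLast?.getD true = true := by
  induction s using Nat.binaryRec' with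
  | zero => simp
  | bit b n h ih =>
    rw [Nat.bits_append_bit n b h, List.getLast?_cons]
    by_cases hn : n = 0
    · subst hn; simp [h rfl]
    · cases hb : n.bits with
      | nil =>
        have := bitsVal_bits n
        rw [hb] at this
        exact absurd this.symm hn
      | cons c l => rw [hb] at ih; simpa [List.getLast?_cons] using ih

lemma bits_two_pow (n : ℕ) : (2 ^ n).bits = List.replicate n false ++ [true] := by
  induction n with
  | zero => simp
  | succ n ih =>
    have := bits_two_mul_add false (2 ^ n) (fun h => by simp at h)
    rw [pow_succ, mul_comm, List.replicate_succ, List.cons_append, ← ih, ← this]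
    rfl

lemma getElem_eq_testBit (l : List Bool) (j : ℕ) (hj : j < l.length) :
    l[j] = (bitsVal l).testBit j := by
  induction l generalizing j with
  | nil => simp at hj
  | cons b l ih =>
    have hv : bitsVal (b :: l) = Nat.bit b (bitsVal l) := by
      rw [Nat.bit_val, bitsVal]; ring
    rw [hv]
    cases j with
    | zero => simp
    | succ j => simpa [Nat.testBit_bit_succ] using ih j (by simpa using hj)

lemma bitsVal_replicate_false (n : ℕ) : bitsVal (List.replicate n false) = 0 := by
  induction n with
  | zero => rfl
  | succ n ih => simp [List.replicate_succ, bitsVal, ih]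

lemma iterate_inc_replicate {n i : ℕ} (hi : i < 2 ^ n) :
    bitsVal (inc^[i] (List.replicate n false)) = i ∧
      (inc^[i] (List.replicate n false)).length = n := by
  induction i with
  | zero => simp [bitsVal_replicate_false]
  | succ i ih =>
    obtain ⟨h₁, h₂⟩ := ih (by omega)
    rw [Function.iterate_succ_apply']
    refine ⟨by rw [bitsVal_inc, h₁], ?_⟩
    rw [length_inc, h₂]
    by_contra hc
    have := bitsVal_of_all (by simpa using hc)
    rw [h₁, h₂] at this
    omega

/-- Counting up from `0` on `n` digits lists the inputs in lexicographic order; the counter has its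
least significant digit first, the input its most significant one. -/
lemma reverse_iterate_inc {n i : ℕ} (hi : i < 2 ^ n) :
    (inc^[i] (List.replicate n false)).reverse = List.ofFn (lexInput n i) := by
  obtain ⟨h₁, h₂⟩ := iterate_inc_replicate hi
  refine List.ext_getElem (by simp [h₂]) fun j hj hj' => ?_
  rw [List.getElem_reverse, getElem_eq_testBit, h₁, h₂]
  simp [lexInput]

/-! ### Lists of gates -/

/-- `gs` is the gate list of a circuit over `B` with `n` inputs. -/
structure ValidGates (B : Set (Bool → Bool → Bool)) (n : ℕ) (gs : List Gate) : Prop where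
  op_mem : ∀ g ∈ gs, g.op ∈ B
  left_lt : ∀ (k : ℕ) (hk : k < gs.length), gs[k].left < n + k
  right_lt : ∀ (k : ℕ) (hk : k < gs.length), gs[k].right < n + k

/-- The values of all wires of the gate list `gs` on the input `v`. -/
def wiresOf (gs : List Gate) (v : List Bool) : List Bool :=
  gs.foldl (fun v g => v ++ [g.op (v.getD g.left false) (v.getD g.right false)]) v

variable {B : Set (Bool → Bool → Bool)} {n : ℕ}

lemma ValidGates.nil : ValidGates B n [] := ⟨by simp, by simp, by simp⟩

lemma validGates_concat {gs : List Gate} {g : Gate} :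
    ValidGates B n (gs ++ [g]) ↔
      ValidGates B n gs ∧ g.op ∈ B ∧ g.left < n + gs.length ∧ g.right < n + gs.length := by
  constructor
  · intro h
    refine ⟨⟨fun g' hg => h.op_mem g' (by simp [hg]), fun k hk => ?_, fun k hk => ?_⟩,
      h.op_mem g (by simp), ?_, ?_⟩
    · have := h.left_lt k (by simp; omega)
      rwa [List.getElem_append_left hk] at this
    · have := h.right_lt k (by simp; omega)
      rwa [List.getElem_append_left hk] at this
    · simpa using h.left_lt gs.length (by simp)
    · simpa using h.right_lt gs.length (by simp)
  · rintro ⟨h, h₁, h₂, h₃⟩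
    refine ⟨fun g' hg => ?_, fun k hk => ?_, fun k hk => ?_⟩
    · rcases List.mem_append.1 hg with hg | hg
      · exact h.op_mem _ hg
      · rw [List.mem_singleton.1 hg]; exact h₁
    all_goals
      rcases lt_or_ge k gs.length with hk' | hk'
      · rw [List.getElem_append_left hk']
        first | exact h.left_lt k hk' | exact h.right_lt k hk'
      · obtain rfl : k = gs.length := by simp at hk; omega
        simpa

lemma wiresOf_concat (gs : List Gate) (g : Gate) (v : List Bool) :
    wiresOf (gs ++ [g]) v = wiresOf gs v ++
      [g.op ((wiresOf gs v).getD g.left false) ((wiresOf gs v).getD g.right false)] := by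
  simp [wiresOf]

lemma length_wiresOf (gs : List Gate) (v : List Bool) :
    (wiresOf gs v).length = v.length + gs.length := by
  induction gs using List.reverseRecOn with
  | nil => simp [wiresOf]
  | append_singleton gs g ih => simp [wiresOf_concat, ih]; omega

lemma Circuit.validGates (C : Circuit B n) : ValidGates B n C.gates :=
  ⟨C.op_mem, C.left_lt, C.right_lt⟩

lemma Circuit.eval_eq (C : Circuit B n) (x : Fin n → Bool) :
    C.eval x = (wiresOf C.gates (List.ofFn x)).getD C.out false := rfl

/-- The operation with the given table of values. -/
def mkOp (q₀ q₁ q₂ q₃ : Bool) (a b : Bool) : Bool := cond a (cond b q₃ q₂) (cond b q₁ q₀)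

lemma mkOp_eq (f : Bool → Bool → Bool) :
    mkOp (f false false) (f false true) (f true false) (f true true) = f := by
  funext a b; cases a <;> cases b <;> rfl

/-! ### Checking a circuit on one input -/

/-- What the next symbol of the code of a circuit means. -/
inductive Mode : Type
  | tag | op₀ | op₁ | op₂ | op₃ | left | right | out | fin
  deriving DecidableEq

instance : Fintype Mode where
  elems := {.tag, .op₀, .op₁, .op₂, .op₃, .left, .right, .out, .fin}
  complete m := by cases m <;> decide

/-- The finite part of the state of the circuit evaluator: the table of the current operation, the
value of the left wire, the value of the last gate or of the output wire, and an error flag. -/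
structure Control : Type where
  mode : Mode
  q₀ : Bool
  q₁ : Bool
  q₂ : Bool
  q₃ : Bool
  lv : Bool
  rv : Bool
  bad : Bool

noncomputable instance : Fintype Control :=
  .ofInjective (fun c => (c.mode, c.q₀, c.q₁, c.q₂, c.q₃, c.lv, c.rv, c.bad))
    (by rintro ⟨⟩ ⟨⟩ h; simp_all)

/-- The state of the circuit evaluator. The wire values known so far are `past.reverse ++ next`;
while a wire name is read, `past` has as many entries as units of the name have been read. The
digits `budget` count the gates up from the complement of the size bound. -/
structure Eval : Type where
  ctl : Control
  next : List Bool
  past : List Bool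
  budget : List Bool

open Classical in
/-- The finite control, when it reads a symbol that is no part of a wire name and no start of a
gate. -/
noncomputable def Control.step (B : Set (Bool → Bool → Bool)) (c : Control) (b : Bool) : Control :=
  match c.mode with
  | .tag => { c with mode := .out }
  | .op₀ => { c with mode := .op₁, q₀ := b }
  | .op₁ => { c with mode := .op₂, q₁ := b }
  | .op₂ => { c with mode := .op₃, q₂ := b }
  | .op₃ => { c with mode := .left, q₃ := b, bad := c.bad || !decide (mkOp c.q₀ c.q₁ c.q₂ b ∈ B) }
  | _ => { c with bad := true }

/-- The circuit evaluator reads one symbol of the code of a circuit. -/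
noncomputable def Eval.step (B : Set (Bool → Bool → Bool)) (r : Eval) (b : Bool) : Eval :=
  match r.ctl.mode, b with
  | .tag, true =>
    ⟨{ r.ctl with mode := .op₀, bad := r.ctl.bad || r.budget.all id }, r.next, r.past, inc r.budget⟩
  | .left, true | .right, true | .out, true =>
    match r.next with
    | [] => ⟨{ r.ctl with bad := true }, [], r.past, r.budget⟩
    | a :: l => ⟨r.ctl, l, a :: r.past, r.budget⟩
  | .left, false =>
    ⟨{ r.ctl with mode := .right, lv := r.next.headD false, bad := r.ctl.bad || r.next.isEmpty },
      r.past.reverse ++ r.next, [], r.budget⟩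
  | .right, false =>
    let a := mkOp r.ctl.q₀ r.ctl.q₁ r.ctl.q₂ r.ctl.q₃ r.ctl.lv (r.next.headD false)
    ⟨{ r.ctl with mode := .tag, rv := a, bad := r.ctl.bad || r.next.isEmpty },
      r.past.reverse ++ r.next ++ [a], [], r.budget⟩
  | .out, false =>
    ⟨{ r.ctl with mode := .fin, rv := r.next.headD false, bad := r.ctl.bad || r.next.isEmpty },
      r.next, r.past, r.budget⟩
  | _, b => { r with ctl := r.ctl.step B b }

/-- The finite control at the start. -/
def Control.init : Control := ⟨.tag, false, false, false, false, false, false, false⟩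

/-- The evaluator at the start, on input `v` and with gate counter `d`. -/
def Eval.init (v d : List Bool) : Eval :=
  ⟨.init, v, [], d⟩

/-- The code of a list of gates. -/
def encodeGates (gs : List Gate) : List Bool := gs.flatMap Gate.encode

lemma encodeGates_concat (gs : List Gate) (g : Gate) :
    encodeGates (gs ++ [g]) = encodeGates gs ++ g.encode := by
  simp [encodeGates]

/-- What is known about the evaluator, if it has found no error in the part `u` of the code that it
has read: `u` is the code of valid gates `gs`, followed by a part of the code of a gate or of the
end of a circuit. -/
def Eval.Inv (B : Set (Bool → Bool → Bool)) (n s m : ℕ) (u : List Bool) (r : Eval) : Prop :=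
  r.budget.length = m ∧ ∃ gs, ValidGates B n gs ∧ r.past.length + r.next.length = n + gs.length ∧
    match r.ctl.mode with
    | .tag => u = encodeGates gs ∧ r.past = [] ∧ bitsVal r.budget + s + 1 = 2 ^ m + gs.length
    | .op₀ => u = encodeGates gs ++ [true] ∧ r.past = [] ∧
        bitsVal r.budget + s = 2 ^ m + gs.length
    | .op₁ => u = encodeGates gs ++ [true, r.ctl.q₀] ∧ r.past = [] ∧
        bitsVal r.budget + s = 2 ^ m + gs.length
    | .op₂ => u = encodeGates gs ++ [true, r.ctl.q₀, r.ctl.q₁] ∧ r.past = [] ∧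
        bitsVal r.budget + s = 2 ^ m + gs.length
    | .op₃ => u = encodeGates gs ++ [true, r.ctl.q₀, r.ctl.q₁, r.ctl.q₂] ∧ r.past = [] ∧
        bitsVal r.budget + s = 2 ^ m + gs.length
    | .left => u = encodeGates gs ++ [true, r.ctl.q₀, r.ctl.q₁, r.ctl.q₂, r.ctl.q₃] ++
          List.replicate r.past.length true ∧
        mkOp r.ctl.q₀ r.ctl.q₁ r.ctl.q₂ r.ctl.q₃ ∈ B ∧ bitsVal r.budget + s = 2 ^ m + gs.length
    | .right => ∃ l < n + gs.length,
        u = encodeGates gs ++ [true, r.ctl.q₀, r.ctl.q₁, r.ctl.q₂, r.ctl.q₃] ++ unary l ++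
          List.replicate r.past.length true ∧
        mkOp r.ctl.q₀ r.ctl.q₁ r.ctl.q₂ r.ctl.q₃ ∈ B ∧ bitsVal r.budget + s = 2 ^ m + gs.length
    | .out => u = encodeGates gs ++ false :: List.replicate r.past.length true ∧
        bitsVal r.budget + s + 1 = 2 ^ m + gs.length
    | .fin => ∃ o < n + gs.length, u = encodeGates gs ++ false :: unary o ∧
        bitsVal r.budget + s + 1 = 2 ^ m + gs.length

lemma Eval.step_bad {r : Eval} {b : Bool} (h : r.ctl.bad = true) :
    (r.step B b).ctl.bad = true := by
  obtain ⟨⟨mode, q₀, q₁, q₂, q₃, lv, rv, bad⟩, next, past, budget⟩ := r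
  simp only at h
  subst h
  cases mode <;> cases b <;> cases next <;> simp [Eval.step, Control.step]

lemma replicate_concat {α : Type*} (k : ℕ) (a : α) :
    List.replicate k a ++ [a] = List.replicate (k + 1) a := by
  rw [List.replicate_succ']

lemma Eval.Inv.step {s m : ℕ} {u : List Bool} {r : Eval} {b : Bool}
    (h : r.Inv B n s m u) (hb : (r.step B b).ctl.bad = false) :
    (r.step B b).Inv B n s m (u ++ [b]) := by
  obtain ⟨⟨mode, q₀, q₁, q₂, q₃, lv, rv, bad⟩, next, past, budget⟩ := r
  obtain ⟨hm, gs, hgs, hlen, h⟩ := h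
  cases mode
  case tag =>
    obtain ⟨hu, hp, hv⟩ := h
    cases b
    · exact ⟨hm, gs, hgs, hlen, by simp_all [Eval.step, Control.step]⟩
    · simp only [Eval.step, Bool.or_eq_false_iff] at hb hm hv ⊢
      refine ⟨by rw [length_inc hb.2, hm], gs, hgs, hlen, by rw [hu], hp, ?_⟩
      simp only [bitsVal_inc]
      omega
  case op₀ => exact ⟨hm, gs, hgs, hlen, by cases b <;> simp_all [Eval.step, Control.step]⟩
  case op₁ => exact ⟨hm, gs, hgs, hlen, by cases b <;> simp_all [Eval.step, Control.step]⟩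
  case op₂ => exact ⟨hm, gs, hgs, hlen, by cases b <;> simp_all [Eval.step, Control.step]⟩
  case op₃ => exact ⟨hm, gs, hgs, hlen, by cases b <;> simp_all [Eval.step, Control.step]⟩
  case left =>
    obtain ⟨hu, ho, hv⟩ := h
    simp only at hu ho hv hlen
    cases b
    · cases next with
      | nil => simp [Eval.step] at hb
      | cons a next =>
        refine ⟨hm, gs, hgs, by simp [Eval.step] at *; omega, past.length, ?_, ?_, ho, hv⟩
        · simp at hlen; omega
        · simp [Eval.step, hu, unary]
    · cases next with
      | nil => simp [Eval.step] at hb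
      | cons a next =>
        refine ⟨hm, gs, hgs, by simp [Eval.step] at *; omega, ?_, ho, hv⟩
        simp [Eval.step, hu, replicate_concat]
  case right =>
    obtain ⟨l, hl, hu, ho, hv⟩ := h
    simp only at hu ho hv hlen
    cases b
    · cases next with
      | nil => simp [Eval.step] at hb
      | cons a next =>
        have hlt : past.length < n + gs.length := by simp at hlen; omega
        refine ⟨hm, gs ++ [⟨mkOp q₀ q₁ q₂ q₃, l, past.length⟩],
          validGates_concat.2 ⟨hgs, ho, hl, hlt⟩, by simp [Eval.step] at *; omega, ?_, rfl, ?_⟩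
        · rw [encodeGates_concat, hu]
          simp [Gate.encode, unary, mkOp]
        · simp [Eval.step]; omega
    · cases next with
      | nil => simp [Eval.step] at hb
      | cons a next =>
        refine ⟨hm, gs, hgs, by simp [Eval.step] at *; omega, l, hl, ?_, ho, hv⟩
        simp [Eval.step, hu, replicate_concat]
  case out =>
    obtain ⟨hu, hv⟩ := h
    simp only at hu hv hlen
    cases b
    · cases next with
      | nil => simp [Eval.step] at hb
      | cons a next =>
        refine ⟨hm, gs, hgs, by simp [Eval.step] at *; omega, past.length, ?_, ?_, hv⟩
        · simp at hlen; omega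
        · simp [hu, unary]
    · cases next with
      | nil => simp [Eval.step] at hb
      | cons a next =>
        refine ⟨hm, gs, hgs, by simp [Eval.step] at *; omega, ?_, hv⟩
        simp [Eval.step, hu, replicate_concat]
  case fin => cases b <;> simp [Eval.step, Control.step] at hb

lemma Eval.Inv.foldl {s m : ℕ} {v d : List Bool} (hv : v.length = n) (hd : d.length = m)
    (hs : bitsVal d + s + 1 = 2 ^ m) (u : List Bool)
    (hb : (u.foldl (Eval.step B) (Eval.init v d)).ctl.bad = false) :
    (u.foldl (Eval.step B) (Eval.init v d)).Inv B n s m u := by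
  induction u using List.reverseRecOn with
  | nil => exact ⟨hd, [], .nil, by simp [Eval.init, hv], by simp [Eval.init, Control.init, encodeGates, hs]⟩
  | append_singleton u b ih =>
    rw [List.foldl_append] at hb ⊢
    simp only [List.foldl_cons, List.foldl_nil] at hb ⊢
    refine Eval.Inv.step (ih ?_) hb
    by_contra h
    rw [Eval.step_bad (by simpa using h)] at hb
    cases hb

/-- The evaluator succeeds only on codes of circuits within the size bound. -/
theorem exists_circuit_of_foldl {s : ℕ} {v : List Bool} (hv : v.length = n) (w : List Bool)
    (hb : (w.foldl (Eval.step B) (Eval.init v (s.bits.map not))).ctl.bad = false)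
    (hf : (w.foldl (Eval.step B) (Eval.init v (s.bits.map not))).ctl.mode = .fin) :
    ∃ C : Circuit B n, w = C.encode ∧ C.size ≤ s := by
  have hs := bitsVal_map_not s.bits
  rw [bitsVal_bits] at hs
  obtain ⟨hm, gs, hgs, hlen, h⟩ :=
    Eval.Inv.foldl (B := B) (s := s) hv (List.length_map ..) hs w hb
  rw [hf] at h
  obtain ⟨o, ho, hw, hval⟩ := h
  refine ⟨⟨gs, o, hgs.op_mem, hgs.left_lt, hgs.right_lt, ho⟩, hw, ?_⟩
  have := bitsVal_lt (w.foldl (Eval.step B) (Eval.init v (s.bits.map not))).budget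
  rw [hm] at this
  simp only [Circuit.size]
  omega

lemma foldl_replicate_true {c : Control} (hc : c.mode = .left ∨ c.mode = .right ∨ c.mode = .out)
    (next past d : List Bool) (i : ℕ) (hi : i ≤ next.length) :
    (List.replicate i true).foldl (Eval.step B) ⟨c, next, past, d⟩ =
      ⟨c, next.drop i, (next.take i).reverse ++ past, d⟩ := by
  induction i generalizing next past with
  | zero => simp
  | succ i ih =>
    cases next with
    | nil => simp at hi
    | cons a next =>
      have : Eval.step B ⟨c, a :: next, past, d⟩ true = ⟨c, next, a :: past, d⟩ := by
        obtain ⟨mode, q₀, q₁, q₂, q₃, lv, rv, bad⟩ := c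
        rcases hc with rfl | rfl | rfl <;> simp [Eval.step]
      rw [List.replicate_succ, List.foldl_cons, this, ih _ _ (by simpa using hi)]
      simp

lemma headD_drop (v : List Bool) (i : ℕ) : (v.drop i).headD false = v.getD i false := by
  simp [List.headD_eq_head?_getD, List.head?_drop, List.getD_eq_getElem?_getD]

lemma isEmpty_drop {v : List Bool} {i : ℕ} (hi : i < v.length) : (v.drop i).isEmpty = false := by
  simp [List.isEmpty_eq_false_iff, hi]

lemma foldl_encode_gate {c : Control} (hc : c.mode = .tag) (hb : c.bad = false) (v d : List Bool)
    (hd : d.all id = false) (g : Gate) (hg : g.op ∈ B) (hl : g.left < v.length)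
    (hr : g.right < v.length) :
    ∃ c' : Control, c'.mode = .tag ∧ c'.bad = false ∧
      g.encode.foldl (Eval.step B) ⟨c, v, [], d⟩ =
        ⟨c', v ++ [g.op (v.getD g.left false) (v.getD g.right false)], [], inc d⟩ := by
  obtain ⟨mode, q₀, q₁, q₂, q₃, lv, rv, bad⟩ := c
  simp only at hc hb
  subst hc hb
  simp only [Gate.encode, unary, List.foldl_append, List.foldl_cons, List.foldl_nil, Eval.step,
    Control.step, hd, mkOp_eq, hg]
  rw [foldl_replicate_true (by simp) _ _ _ _ hl.le]
  simp only [isEmpty_drop hl, List.append_nil, List.reverse_reverse,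
    List.take_append_drop]
  rw [foldl_replicate_true (by simp) _ _ _ _ hr.le]
  simp only [isEmpty_drop hr, headD_drop, List.append_nil, List.reverse_reverse,
    List.take_append_drop, mkOp_eq]
  exact ⟨_, rfl, by simp, rfl⟩

lemma foldl_encodeGates {s : ℕ} (v : List Bool) (hv : v.length = n) (gs : List Gate)
    (hgs : ValidGates B n gs) (hs : gs.length ≤ s) :
    ∃ (c : Control) (d : List Bool), c.mode = .tag ∧ c.bad = false ∧
      d.length = s.bits.length ∧ bitsVal d + s + 1 = 2 ^ s.bits.length + gs.length ∧
      (encodeGates gs).foldl (Eval.step B) (Eval.init v (s.bits.map not)) =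
        ⟨c, wiresOf gs v, [], d⟩ := by
  induction gs using List.reverseRecOn with
  | nil =>
    have h := bitsVal_map_not s.bits
    rw [bitsVal_bits] at h
    exact ⟨_, _, rfl, rfl, List.length_map .., h, rfl⟩
  | append_singleton gs g ih =>
    rw [validGates_concat] at hgs
    simp only [List.length_append, List.length_singleton] at hs
    obtain ⟨c, d, hc, hb, hd, hval, h⟩ := ih hgs.1 (by omega)
    -- The counter cannot overflow, because `gs` has fewer than `s` gates.
    have hcarry : d.all id = false := by
      by_contra hd'
      have := bitsVal_of_all (by simpa using hd')
      rw [hd] at this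
      omega
    obtain ⟨c', hc', hb', h'⟩ := foldl_encode_gate hc hb (wiresOf gs v) d hcarry g hgs.2.1
      (by rw [length_wiresOf, hv]; exact hgs.2.2.1) (by rw [length_wiresOf, hv]; exact hgs.2.2.2)
    refine ⟨c', inc d, hc', hb', by rw [length_inc hcarry, hd], ?_, ?_⟩
    · rw [bitsVal_inc]; simp; omega
    · rw [encodeGates_concat, List.foldl_append, h, h', wiresOf_concat]

/-- On the code of a circuit within the size bound, the evaluator finds the value of the circuit. -/
theorem foldl_circuit_encode {s : ℕ} (C : Circuit B n) (hs : C.size ≤ s) (x : Fin n → Bool) :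
    let r := C.encode.foldl (Eval.step B) (Eval.init (List.ofFn x) (s.bits.map not))
    r.ctl.bad = false ∧ r.ctl.mode = .fin ∧ r.ctl.rv = C.eval x := by
  obtain ⟨c, d, hc, hb, hd, hval, h⟩ :=
    foldl_encodeGates (List.ofFn x) (List.length_ofFn) C.gates C.validGates hs
  obtain ⟨mode, q₀, q₁, q₂, q₃, lv, rv, bad⟩ := c
  simp only at hc hb
  subst hc hb
  have hout : C.out < (wiresOf C.gates (List.ofFn x)).length := by
    rw [length_wiresOf, List.length_ofFn]; exact C.out_lt
  rw [Circuit.encode, ← encodeGates, List.foldl_append, h]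
  simp only [unary, List.foldl_cons, List.foldl_append, List.foldl_nil, Eval.step, Control.step]
  rw [foldl_replicate_true (by simp) _ _ _ _ hout.le]
  simp [isEmpty_drop hout, Circuit.eval_eq]

/-! ### Reading the input -/

/-- What the next symbol of the input means: a tag or a bit of the truth table, a digit of the size
bound, or a symbol of the certificate. -/
inductive Section : Type
  | tag | bit | num | cert
  deriving DecidableEq

instance : Fintype Section where
  elems := {.tag, .bit, .num, .cert}
  complete m := by cases m <;> decide

/-- The state of the parser: the section of the input that it is in, the last digit read of the size
bound, an error flag, and in reverse order the truth table, the complemented digits of the size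
bound, and the certificate. -/
structure Parse : Type where
  mode : Section
  last : Bool
  bad : Bool
  table : List Bool
  size : List Bool
  cert : List Bool

/-- The parser reads one symbol. -/
def Parse.step (p : Parse) (a : Option Bool) : Parse :=
  match p.mode, a with
  | .tag, some true => { p with mode := .bit }
  | .tag, some false => { p with mode := .num }
  | .tag, none => { p with mode := .cert, bad := true }
  | .bit, some b => { p with mode := .tag, table := b :: p.table }
  | .bit, none => { p with mode := .cert, bad := true }
  | .num, some b => { p with last := b, size := (!b) :: p.size }
  | .num, none => { p with mode := .cert, bad := p.bad || !p.last }
  | .cert, some b => { p with cert := b :: p.cert }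
  | .cert, none => { p with bad := true }

/-- The parser at the start. A size bound without digits counts as one whose last digit is `1`. -/
def Parse.init : Parse := ⟨.tag, true, false, [], [], []⟩

/-- The parsed input. -/
def parse (x w : List Bool) : Parse := (encodePair (x, w)).foldl Parse.step Parse.init

lemma foldl_parse_cert (p : Parse) (hp : p.mode = .cert) (w : List Bool) :
    (w.map some).foldl Parse.step p = { p with cert := w.reverse ++ p.cert } := by
  induction w generalizing p with
  | nil => simp
  | cons b w ih =>
    obtain ⟨mode, last, bad, T, S, W⟩ := p
    simp only at hp
    subst hp
    simp [Parse.step, ih]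

/-- The parts of `x` that the parser has seen before the separator. -/
lemma foldl_parse_instance (x : List Bool) :
    ∃ T d : List Bool,
      ((x = T.flatMap (fun b => [true, b]) ∧
          (x.map some).foldl Parse.step Parse.init = ⟨.tag, true, false, T.reverse, [], []⟩) ∨
        (x = T.flatMap (fun b => [true, b]) ++ [true] ∧
          (x.map some).foldl Parse.step Parse.init = ⟨.bit, true, false, T.reverse, [], []⟩) ∨
        (x = T.flatMap (fun b => [true, b]) ++ false :: d ∧
          (x.map some).foldl Parse.step Parse.init =
            ⟨.num, d.getLast?.getD true, false, T.reverse, (d.map not).reverse, []⟩)) := by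
  induction x using List.reverseRecOn with
  | nil => exact ⟨[], [], .inl ⟨rfl, rfl⟩⟩
  | append_singleton x b ih =>
    obtain ⟨T, d, ⟨hx, h⟩ | ⟨hx, h⟩ | ⟨hx, h⟩⟩ := ih
    · cases b
      · exact ⟨T, [], .inr (.inr ⟨by rw [hx], by simp [h, Parse.step]⟩)⟩
      · exact ⟨T, [], .inr (.inl ⟨by rw [hx], by simp [h, Parse.step]⟩)⟩
    · exact ⟨T ++ [b], [], .inl ⟨by simp [hx], by simp [h, Parse.step]⟩⟩
    · exact ⟨T, d ++ [b], .inr (.inr ⟨by simp [hx], by simp [h, Parse.step]⟩)⟩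

lemma foldl_parse_table (T : List Bool) (p : Parse) (hp : p.mode = .tag) :
    ((T.flatMap fun b => [true, b]).map some).foldl Parse.step p =
      { p with table := T.reverse ++ p.table } := by
  induction T generalizing p with
  | nil => simp
  | cons b T ih =>
    obtain ⟨mode, last, bad, T', S, W⟩ := p
    simp only at hp
    subst hp
    simp only [List.flatMap_cons, List.cons_append, List.nil_append, List.map_cons,
      List.foldl_cons, Parse.step]
    rw [ih _ rfl]
    simp

lemma foldl_parse_size (d : List Bool) (p : Parse) (hp : p.mode = .num) :
    (d.map some).foldl Parse.step p =
      { p with last := d.getLast?.getD p.last, size := (d.map not).reverse ++ p.size } := by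
  induction d generalizing p with
  | nil => simp
  | cons b d ih =>
    obtain ⟨mode, last, bad, T', S, W⟩ := p
    simp only at hp
    subst hp
    simp only [List.map_cons, List.foldl_cons, Parse.step]
    rw [ih _ rfl]
    simp [List.getLast?_cons]

lemma parse_encodeInstance (T : List Bool) (s : ℕ) (w : List Bool) :
    parse (encodeInstance T s) w =
      ⟨.cert, true, false, T.reverse, (s.bits.map not).reverse, w.reverse⟩ := by
  simp only [parse, encodePair, encodeInstance, List.map_append, List.map_cons, List.foldl_append,
    List.foldl_cons]
  rw [foldl_parse_table _ _ rfl]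
  have h₁ (T' : List Bool) : Parse.step { Parse.init with table := T' } (some false) =
      ⟨.num, true, false, T', [], []⟩ := rfl
  rw [h₁, foldl_parse_size s.bits _ rfl]
  simp only [getLast?_bits, Parse.step]
  rw [foldl_parse_cert _ rfl]
  simp [Parse.init]

lemma exists_eq_encodeInstance {x w : List Bool} (h : (parse x w).bad = false) :
    ∃ T s, x = encodeInstance T s := by
  simp only [parse, encodePair, List.foldl_append, List.foldl_cons] at h
  obtain ⟨T, d, ⟨hx, hp⟩ | ⟨hx, hp⟩ | ⟨hx, hp⟩⟩ := foldl_parse_instance x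
  · rw [hp] at h
    simp only [Parse.step] at h
    rw [foldl_parse_cert _ rfl] at h
    simp at h
  · rw [hp] at h
    simp only [Parse.step] at h
    rw [foldl_parse_cert _ rfl] at h
    simp at h
  · rw [hp] at h
    simp only [Parse.step] at h
    rw [foldl_parse_cert _ rfl] at h
    simp only [Bool.false_or, Bool.not_eq_false'] at h
    obtain ⟨s, rfl⟩ := exists_bits_eq d h
    exact ⟨T, s, hx⟩

/-- The parser stores at most as many symbols as it reads. -/
lemma length_parse (l : List (Option Bool)) (p : Parse) :
    (l.foldl Parse.step p).table.length + (l.foldl Parse.step p).size.length +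
      (l.foldl Parse.step p).cert.length ≤
      p.table.length + p.size.length + p.cert.length + l.length := by
  induction l generalizing p with
  | nil => simp
  | cons a l ih =>
    refine (ih (p.step a)).trans ?_
    obtain ⟨mode, last, bad, T, S, W⟩ := p
    cases mode <;> rcases a with _ | _ | _ <;> simp [Parse.step] <;> omega

/-! ### The verifier as a function on lists -/

/-- One digit of a binary number is compared with those of a power of two, `0 … 01`: the state is
whether the `1` has been seen, an error flag, and the zeros seen. -/
def powStep (p : Bool × Bool × List Bool) (b : Bool) : Bool × Bool × List Bool :=
  (p.1 || b, p.2.1 || p.1, cond b p.2.2 (false :: p.2.2))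

lemma foldl_powStep_bad (l : List Bool) (p : Bool × Bool × List Bool) (hp : p.2.1 = true) :
    (l.foldl powStep p).2.1 = true := by
  induction l generalizing p with
  | nil => exact hp
  | cons b l ih => exact ih _ (by simp [powStep, hp])

lemma foldl_powStep_replicate (n : ℕ) (e : Bool) (z : List Bool) :
    (List.replicate n false ++ [true]).foldl powStep (false, e, z) =
      (true, e, List.replicate n false ++ z) := by
  induction n generalizing z with
  | zero => simp [powStep]
  | succ n ih =>
    rw [List.replicate_succ, List.cons_append, List.foldl_cons]
    simp only [powStep, Bool.or_false, cond_false]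
    rw [ih, ← List.replicate_succ, List.replicate_succ']
    simp

lemma foldl_powStep_good (l z : List Bool) (h₁ : (l.foldl powStep (false, false, z)).1 = true)
    (h₂ : (l.foldl powStep (false, false, z)).2.1 = false) :
    ∃ n, l = List.replicate n false ++ [true] := by
  induction l generalizing z with
  | nil => simp at h₁
  | cons b l ih =>
    cases b
    · simp only [List.foldl_cons, powStep, Bool.or_false, cond_false] at h₁ h₂
      obtain ⟨n, rfl⟩ := ih _ h₁ h₂
      exact ⟨n + 1, by simp [List.replicate_succ]⟩
    · cases l with
      | nil => exact ⟨0, rfl⟩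
      | cons c l =>
        simp only [List.foldl_cons] at h₂
        rw [foldl_powStep_bad _ _ (by simp [powStep])] at h₂
        cases h₂

lemma length_foldl_powStep (l : List Bool) (p : Bool × Bool × List Bool) :
    (l.foldl powStep p).2.2.length ≤ p.2.2.length + l.length := by
  induction l generalizing p with
  | nil => simp
  | cons b l ih =>
    refine (ih _).trans ?_
    cases b
    · simp [powStep]; omega
    · simp [powStep]

/-- The result of the evaluator on input `X` (least significant digit first). -/
noncomputable def evalRow (B : Set (Bool → Bool → Bool)) (S W X : List Bool) : Eval :=
  W.foldl (Eval.step B) (Eval.init X.reverse S)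

/-- The evaluator failed, or its result differs from the entry `t` of the truth table. -/
def Control.fails (c : Control) (t : Bool) : Bool :=
  c.bad || !decide (c.mode = .fin) || xor c.rv t

/-- One entry of the truth table is checked, and the input is advanced. The state is an error flag
and the current input. -/
noncomputable def tableStep (B : Set (Bool → Bool → Bool)) (S W : List Bool)
    (p : Bool × List Bool) (t : Bool) : Bool × List Bool :=
  (p.1 || (evalRow B S W p.2).ctl.fails t, inc p.2)

lemma foldl_tableStep (S W T : List Bool) (p : Bool × List Bool) :
    (T.foldl (tableStep B S W) p).1 = false ↔ p.1 = false ∧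
      ∀ (i : ℕ) (hi : i < T.length),
        (evalRow B S W (inc^[i] p.2)).ctl.fails T[i] = false := by
  induction T generalizing p with
  | nil => simp
  | cons t T ih =>
    rw [List.foldl_cons, ih]
    simp only [tableStep, Bool.or_eq_false_iff]
    constructor
    · rintro ⟨⟨h₁, h₂⟩, h₃⟩
      refine ⟨h₁, fun i hi => ?_⟩
      cases i with
      | zero => exact h₂
      | succ i => exact h₃ i (by simpa using hi)
    · rintro ⟨h₁, h₂⟩
      exact ⟨⟨h₁, h₂ 0 (by simp)⟩, fun i hi => h₂ (i + 1) (by simpa using hi)⟩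

/-- The comparison of the length of the truth table with the powers of two. -/
def powTest (p : Parse) : Bool × Bool × List Bool :=
  (inc^[p.table.length] []).foldl powStep (false, p.bad, [])

/-- The error flag of the verifier at the end of its computation. -/
noncomputable def rejects (B : Set (Bool → Bool → Bool)) (p : Parse) : Bool :=
  (p.table.reverse.foldl (tableStep B p.size.reverse p.cert.reverse)
    ((powTest p).2.1 || !(powTest p).1, (powTest p).2.2)).1

lemma Control.fails_eq_false {c : Control} {t : Bool} :
    c.fails t = false ↔ c.bad = false ∧ c.mode = .fin ∧ c.rv = t := by
  simp [Control.fails, and_assoc]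

theorem rejects_parse_eq_false_iff (x w : List Bool) :
    rejects B (parse x w) = false ↔ CircuitCertifies B x w := by
  constructor
  · intro h
    rw [rejects, foldl_tableStep] at h
    obtain ⟨h₁, h₂⟩ := h
    simp only [Bool.or_eq_false_iff, Bool.not_eq_false'] at h₁
    -- The error flag of the parser is passed on and never cleared.
    have hbad : (parse x w).bad = false := by
      by_contra hb
      rw [powTest, foldl_powStep_bad _ _ (by simpa using hb)] at h₁
      cases h₁.1
    obtain ⟨T, s, rfl⟩ := exists_eq_encodeInstance hbad
    refine ⟨T, s, rfl, ?_⟩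
    rw [parse_encodeInstance] at h₁ h₂
    simp only [powTest, List.length_reverse, iterate_inc_nil] at h₁ h₂
    obtain ⟨n, hn⟩ := foldl_powStep_good _ _ h₁.2 h₁.1
    have hT : T.length = 2 ^ n := by
      rw [← bitsVal_bits T.length, hn, ← bits_two_pow, bitsVal_bits]
    rw [hn, foldl_powStep_replicate] at h₂
    simp only [List.reverse_reverse, List.append_nil, Control.fails_eq_false] at h₂
    -- The first row yields the circuit, since a power of two is positive.
    obtain ⟨hb, hf, -⟩ := h₂ 0 (by rw [hT]; positivity)
    obtain ⟨C, rfl, hC⟩ := exists_circuit_of_foldl (n := n) (by simp) w hb hf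
    refine ⟨n, C, rfl, hC, ?_⟩
    refine List.ext_getElem (by simp [truthTable, hT]) fun i hi hi' => ?_
    have hi₂ : i < 2 ^ n := by simpa [truthTable] using hi
    obtain ⟨-, -, h⟩ := h₂ i hi'
    rw [evalRow, reverse_iterate_inc hi₂] at h
    rw [← h, (foldl_circuit_encode C hC _).2.2]
    simp [truthTable]
  · rintro ⟨T, s, rfl, n, C, rfl, hC, rfl⟩
    rw [rejects, foldl_tableStep, parse_encodeInstance, powTest]
    have hT : (truthTable C.eval).length = 2 ^ n := by simp [truthTable]
    simp only [List.length_reverse, hT, iterate_inc_nil, bits_two_pow, foldl_powStep_replicate,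
      List.reverse_reverse, List.append_nil]
    refine ⟨rfl, fun i hi => ?_⟩
    rw [Control.fails_eq_false, evalRow, reverse_iterate_inc hi]
    refine ⟨(foldl_circuit_encode C hC _).1, (foldl_circuit_encode C hC _).2.1, ?_⟩
    rw [(foldl_circuit_encode C hC _).2.2]
    simp [truthTable]

/-! ### Program library -/

/-- The work stacks of the verifier: the truth table, the size bound, the certificate and its part
that has been read, the current input of the circuit, the lists of `Eval`, an auxiliary stack, and
the output. -/
inductive Store : Type
  | table | size | cert | used | input | next | past | budget | aux | out
  deriving DecidableEq

instance : Fintype Store where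
  elems := {.table, .size, .cert, .used, .input, .next, .past, .budget, .aux, .out}
  complete m := by cases m <;> decide

/-- The register of the verifier: the finite parts of `Eval`, of `Parse` and of `powStep`, the
current entry of the truth table, and the last symbols that were popped. -/
@[ext] structure Reg : Type where
  ctl : Control
  sec : Section
  last : Bool
  bad : Bool
  seen : Bool
  entry : Bool
  cur : Option Bool
  sym : Option (Option Bool)

noncomputable instance : Fintype Reg :=
  .ofInjective (fun v => (v.ctl, v.sec, v.last, v.bad, v.seen, v.entry, v.cur, v.sym))
    (by rintro ⟨⟩ ⟨⟩ h; simp_all)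

/-- The programs of the verifier. -/
abbrev Program : Type := Prog Store Reg

/-- The memories of the verifier. -/
abbrev State : Type := Memory Store Reg

/-- Replace the contents of the stack `k` and the last bit that was popped. -/
def State.set (s : State) (k : Store) (l : List Bool) (o : Option Bool) : State :=
  ⟨{ s.reg with cur := o }, s.inp, Function.update s.stk k l⟩

/-- Pop a bit and remember it. -/
def popTo (k : Store) : Program := .pop k fun v a => { v with cur := a }

/-- Push the bit that was popped last. -/
def pushCur (k : Store) : Program := .push k fun v => v.cur.getD false

/-- Empty the stack `k`, and execute `p` for each of its entries. -/
def forEach (k : Store) (p : Program) : Program :=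
  .seq (popTo k) (.loop (fun v => v.cur.isSome) (.seq p (popTo k)))

/-- Empty the stack `k`. -/
def clear (k : Store) : Program := forEach k (.load id)

/-- Move the entries of the stack `a` to the stack `b`, which reverses their order. -/
def drain (a b : Store) : Program := forEach a (pushCur b)

/-- Move the entries of the stack `a` to both `b` and `c`, which reverses their order. -/
def drain₂ (a b c : Store) : Program := forEach a (.seq (pushCur b) (pushCur c))

/-- Add one to the binary number in `k`. The function `f` is applied to the register when the
lowest digit `0` has been found, or no digit if there is no such digit. -/
def incr (k : Store) (f : Reg → Reg) : Program :=
  .seq (popTo k) <|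
  .seq (.loop (fun v => v.cur == some true) (.seq (.push .aux fun _ => false) (popTo k))) <|
  .seq (.load f) <| .seq (.push k fun _ => true) (drain .aux k)

lemma Runs.cast {p : Program} {s s' s'' : State} {t t' : ℕ} (h : Runs p s s' t) (hs : s' = s'')
    (ht : t ≤ t') : Runs p s s'' t' := hs ▸ h.mono ht

lemma Runs.of_flat {p : Program} {s s' : State} (h : p.flat = true) (hs : p.run s = s') :
    Runs p s s' 0 := hs ▸ Runs.flat s h

/-- A loop over the entries of a stack computes a fold. Here `g r` is the memory that represents
the state `r`, up to the contents of the stack and the last bit that was popped, and `I` is an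
invariant of the fold from which the cost bound for the loop body follows. -/
theorem Runs.forEach {R : Type} {k : Store} {p : Program} (g : R → State) (f : R → Bool → R)
    (I : List Bool → R → Prop) (t : ℕ)
    (h : ∀ b l r, I (b :: l) r →
      I l (f r b) ∧ ∃ o, Runs p ((g r).set k l (some b)) ((g (f r b)).set k l o) t)
    (l : List Bool) (r : R) (hI : I l r) (o : Option Bool) :
    Runs (forEach k p) ((g r).set k l o) ((g (l.foldl f r)).set k [] none)
      ((t + 1) * l.length + 1) := by
  have hpop (r : R) (l : List Bool) (o : Option Bool) :
      Runs (popTo k) ((g r).set k l o) ((g r).set k l.tail l.head?) 0 := by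
    refine Runs.of_flat rfl ?_
    simp [popTo, Prog.run, State.set]
  refine ((hpop r l o).seq (t' := (t + 1) * l.length + 1) ?_).mono (by omega)
  clear o
  induction l generalizing r with
  | nil => exact Runs.loop_done rfl |>.mono (by simp)
  | cons b l ih =>
    obtain ⟨hI', o, hb⟩ := h b l r hI
    refine (Runs.loop_next (by rfl) (hb.seq (hpop _ l o)) (ih _ hI')).mono ?_
    simp only [List.length_cons, Nat.mul_add]
    omega

lemma State.set_self (s : State) (k : Store) : s.set k (s.stk k) s.reg.cur = s := by
  simp [State.set]

lemma runs_clear (k : Store) (s : State) :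
    Runs (clear k) s (s.set k [] none) ((s.stk k).length + 1) := by
  have := Runs.forEach (k := k) (p := .load id) (fun _ : Unit => s) (fun _ _ => ())
    (fun _ _ => True) 0 (fun b l r _ => ⟨trivial, _, Runs.of_flat rfl rfl⟩) (s.stk k) () trivial
    s.reg.cur
  rw [State.set_self] at this
  exact this.mono (by simp)

lemma foldl_cons_reverse (l z : List Bool) : l.foldl (fun z b => b :: z) z = l.reverse ++ z := by
  induction l generalizing z with
  | nil => rfl
  | cons b l ih => simp [ih]

lemma runs_drain {a b : Store} (hab : a ≠ b) (s : State) :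
    Runs (drain a b) s
      ⟨{ s.reg with cur := none }, s.inp,
        Function.update (Function.update s.stk b ((s.stk a).reverse ++ s.stk b)) a []⟩
      ((s.stk a).length + 1) := by
  have := Runs.forEach (k := a) (p := pushCur b)
    (fun z => (⟨s.reg, s.inp, Function.update s.stk b z⟩ : State)) (fun z c => c :: z)
    (fun _ _ => True) 0 (fun c l z _ => ⟨trivial, some c, Runs.of_flat rfl (by
      simp [pushCur, Prog.run, State.set, hab.symm, Function.update_comm hab])⟩)
    (s.stk a) (s.stk b) trivial s.reg.cur
  rw [foldl_cons_reverse] at this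
  simp only [Function.update_eq_self] at this
  rw [State.set_self] at this
  exact this.mono (by simp)

lemma foldl_cons_cons_reverse (l z z' : List Bool) :
    l.foldl (fun z b => (b :: z.1, b :: z.2)) (z, z') = (l.reverse ++ z, l.reverse ++ z') := by
  induction l generalizing z z' with
  | nil => rfl
  | cons b l ih => simp [ih]

lemma runs_drain₂ {a b c : Store} (hab : a ≠ b) (hac : a ≠ c) (hbc : b ≠ c) (s : State) :
    Runs (drain₂ a b c) s
      ⟨{ s.reg with cur := none }, s.inp,
        Function.update (Function.update (Function.update s.stk b ((s.stk a).reverse ++ s.stk b))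
          c ((s.stk a).reverse ++ s.stk c)) a []⟩
      ((s.stk a).length + 1) := by
  have := Runs.forEach (k := a) (p := .seq (pushCur b) (pushCur c))
    (fun z : List Bool × List Bool =>
      (⟨s.reg, s.inp, Function.update (Function.update s.stk b z.1) c z.2⟩ : State))
    (fun z d => (d :: z.1, d :: z.2))
    (fun _ _ => True) 0 (fun d l z _ => ⟨trivial, some d, Runs.of_flat rfl (by
      simp only [pushCur, Prog.run, State.set]
      congr 1
      funext j
      by_cases h₁ : j = a <;> by_cases h₂ : j = b <;> by_cases h₃ : j = c <;>
        simp_all [Function.update_apply])⟩)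
    (s.stk a) (s.stk b, s.stk c) trivial s.reg.cur
  rw [foldl_cons_cons_reverse] at this
  simp only [Function.update_eq_self] at this
  rw [State.set_self] at this
  exact this.mono (by simp)

/-- The effect of `inc`, in terms of the number `i` of digits `1` below the lowest digit `0`. -/
lemma exists_inc_eq (l : List Bool) : ∃ (i : ℕ) (l' : List Bool),
    i ≤ l.length ∧ inc l = List.replicate i false ++ true :: l' ∧
    ((l = List.replicate i true ∧ l' = [] ∧ l.all id = true) ∨
      (l = List.replicate i true ++ false :: l' ∧ l.all id = false)) := by
  induction l with
  | nil => exact ⟨0, [], le_rfl, rfl, .inl ⟨rfl, rfl, rfl⟩⟩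
  | cons b l ih =>
    cases b
    · exact ⟨0, l, by simp, rfl, .inr ⟨rfl, rfl⟩⟩
    · obtain ⟨i, l', hi, hl, h⟩ := ih
      refine ⟨i + 1, l', by simpa using hi, by simp [inc, hl, List.replicate_succ], ?_⟩
      obtain ⟨h₁, h₂, h₃⟩ | ⟨h₁, h₂⟩ := h
      · exact .inl ⟨by rw [List.replicate_succ, ← h₁], h₂, by simpa using h₃⟩
      · exact .inr ⟨by rw [List.replicate_succ, List.cons_append, ← h₁], by simpa using h₂⟩

/-- The carry: the digits `1` below the lowest digit `0` are moved to `aux` as digits `0`. -/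
lemma runs_incr_loop {k : Store} (hk : k ≠ .aux) (i : ℕ) (l z : List Bool) (s : State)
    (hl : l.head? ≠ some true) :
    Runs (.loop (fun v => v.cur == some true) (.seq (.push .aux fun _ => false) (popTo k)))
      (State.set ⟨s.reg, s.inp, Function.update s.stk .aux z⟩ k
        (List.replicate i true ++ l).tail (List.replicate i true ++ l).head?)
      (State.set ⟨s.reg, s.inp, Function.update s.stk .aux (List.replicate i false ++ z)⟩ k
        l.tail l.head?) (i + 1) := by
  induction i generalizing z with
  | zero => exact Runs.loop_done (by simp [State.set, hl]) |>.mono (by simp)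
  | succ i ih =>
    refine (Runs.loop_next (t := 0) (by rfl) (Runs.of_flat rfl ?_)
      ((ih (false :: z)).cast ?_ le_rfl)).mono (by omega)
    · simp [popTo, Prog.run, State.set, List.replicate_succ, hk.symm, Function.update_comm hk]
    · rw [List.replicate_succ', List.append_assoc]; rfl

/-- The register passed to `f` has in `cur` the lowest digit `0`, or nothing if all digits are
`1`. -/
lemma runs_incr {k : Store} (hk : k ≠ .aux) (f : Reg → Reg) (s : State) (hs : s.stk .aux = []) :
    Runs (incr k f) s
      ⟨{ f { s.reg with cur := cond ((s.stk k).all id) none (some false) } with cur := none },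
        s.inp, Function.update s.stk k (inc (s.stk k))⟩
      (2 * (s.stk k).length + 2) := by
  obtain ⟨i, l', hi, hinc, h⟩ := exists_inc_eq (s.stk k)
  obtain ⟨l, hl, hk', hlt, hlh⟩ : ∃ l : List Bool, l.head? ≠ some true ∧
      s.stk k = List.replicate i true ++ l ∧ l.tail = l' ∧
      l.head? = cond ((s.stk k).all id) none (some false) := by
    obtain ⟨h₁, h₂, h₃⟩ | ⟨h₁, h₂⟩ := h
    · exact ⟨[], by simp, by simpa using h₁, h₂.symm, by rw [h₃]; rfl⟩
    · exact ⟨false :: l', by simp, h₁, rfl, by rw [h₂]; rfl⟩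
  have hloop := runs_incr_loop hk i l [] s hl
  rw [← hk', ← hs, hlt, hlh] at hloop
  refine (Runs.seq (t := 0) (Runs.of_flat rfl ?_) (Runs.seq hloop
    (Runs.seq (Runs.flat _ rfl) (Runs.seq (Runs.flat _ rfl) (runs_drain hk.symm _))))).cast ?_ ?_
  · simp [popTo, Prog.run, State.set]
  · have hk₂ := hk.symm
    simp only [Prog.run, State.set, hinc]
    congr 1
    funext j
    by_cases h₁ : j = k <;> by_cases h₂ : j = .aux <;>
      simp_all
  · simp [Prog.run, State.set, hs, hk.symm]
    omega

/-! ### The verifier as a program -/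

/-- The contents of the stacks of the verifier. -/
structure Bank : Type where
  table : List Bool := []
  size : List Bool := []
  cert : List Bool := []
  used : List Bool := []
  input : List Bool := []
  next : List Bool := []
  past : List Bool := []
  budget : List Bool := []
  aux : List Bool := []
  out : List Bool := []

/-- The stacks as a family. -/
@[simp] def Bank.get (m : Bank) : Store → List Bool
  | .table => m.table
  | .size => m.size
  | .cert => m.cert
  | .used => m.used
  | .input => m.input
  | .next => m.next
  | .past => m.past
  | .budget => m.budget
  | .aux => m.aux
  | .out => m.out

section BankUpdate

variable (m : Bank) (l : List Bool)

@[simp] lemma Bank.update_table :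
    Function.update m.get .table l = Bank.get { m with table := l } := by
  funext k; cases k <;> rfl
@[simp] lemma Bank.update_size :
    Function.update m.get .size l = Bank.get { m with size := l } := by
  funext k; cases k <;> rfl
@[simp] lemma Bank.update_cert :
    Function.update m.get .cert l = Bank.get { m with cert := l } := by
  funext k; cases k <;> rfl
@[simp] lemma Bank.update_used :
    Function.update m.get .used l = Bank.get { m with used := l } := by
  funext k; cases k <;> rfl
@[simp] lemma Bank.update_input :
    Function.update m.get .input l = Bank.get { m with input := l } := by
  funext k; cases k <;> rfl
@[simp] lemma Bank.update_next :
    Function.update m.get .next l = Bank.get { m with next := l } := by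
  funext k; cases k <;> rfl
@[simp] lemma Bank.update_past :
    Function.update m.get .past l = Bank.get { m with past := l } := by
  funext k; cases k <;> rfl
@[simp] lemma Bank.update_budget :
    Function.update m.get .budget l = Bank.get { m with budget := l } := by
  funext k; cases k <;> rfl
@[simp] lemma Bank.update_aux :
    Function.update m.get .aux l = Bank.get { m with aux := l } := by
  funext k; cases k <;> rfl
@[simp] lemma Bank.update_out :
    Function.update m.get .out l = Bank.get { m with out := l } := by
  funext k; cases k <;> rfl

end BankUpdate

/-- The memory with register `v` and work stacks `m`, when the input has been read. -/
@[simp] def state (v : Reg) (m : Bank) : State := ⟨v, [], m.get⟩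

/-- The symbol is read inside of a wire name. -/
def Mode.isWire : Mode → Bool
  | .left | .right | .out => true
  | _ => false

/-- Set the error flag of the evaluator if there was nothing to pop. -/
def Reg.guard (v : Reg) : Reg :=
  { v with ctl := { v.ctl with bad := v.ctl.bad || v.cur.isNone } }

/-- Look up the value of the wire whose name has been read, and leave it in the register. -/
def lookup : Program :=
  .seq (popTo .next) (.seq (.ite (fun v => v.cur.isSome) (pushCur .next) (.load id))
    (.load Reg.guard))

/-- The end of a wire name. The value of a gate is appended behind those of all earlier wires, for
which they are moved to `past` and back. -/
def endWire : Program :=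
  .seq lookup <|
  .ite (fun v => v.ctl.mode == .out)
    (.load fun v => { v with ctl := { v.ctl with mode := .fin, rv := v.cur.getD false } }) <|
  .ite (fun v => v.ctl.mode == .left)
    (.seq (.load fun v => { v with ctl := { v.ctl with mode := .right, lv := v.cur.getD false } })
      (drain .past .next))
    (.seq (.load fun v => { v with ctl := { v.ctl with
        mode := .tag, rv := mkOp v.ctl.q₀ v.ctl.q₁ v.ctl.q₂ v.ctl.q₃ v.ctl.lv (v.cur.getD false) } })
      (.seq (drain .past .next) (.seq (drain .next .past)
        (.seq (.push .past fun v => v.ctl.rv) (drain .past .next)))))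

/-- One step of the evaluator. -/
noncomputable def evalBody (B : Set (Bool → Bool → Bool)) : Program :=
  .seq (pushCur .used) <|
  .ite (fun v => v.ctl.mode == .tag && v.cur == some true)
    (.seq (incr .budget Reg.guard)
      (.load fun v => { v with ctl := { v.ctl with mode := .op₀ } })) <|
  .ite (fun v => v.ctl.mode.isWire)
    (.ite (fun v => v.cur == some true)
      (.seq (popTo .next) (.ite (fun v => v.cur.isSome) (pushCur .past) (.load Reg.guard)))
      endWire)
    (.load fun v => { v with ctl := v.ctl.step B (v.cur.getD false) })

/-- The memory that represents the state `r` of the evaluator after it has read `u.reverse`. -/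
@[simp] def evalState (v : Reg) (m : Bank) (p : Eval × List Bool) : State :=
  state { v with ctl := p.1.ctl }
    { m with next := p.1.next, past := p.1.past, budget := p.1.budget, used := p.2 }

/-- The most expensive steps are the increment of the gate counter, and the end of a gate, where all
wire values are moved three times. -/
lemma runs_evalBody (v : Reg) (m : Bank) (hm : m.aux = []) (r : Eval) (u l : List Bool)
    (b : Bool) :
    ∃ o, Runs (evalBody B) ((evalState v m (r, u)).set .cert l (some b))
      ((evalState v m (r.step B b, b :: u)).set .cert l o)
      (3 * (r.next.length + r.past.length) + 2 * r.budget.length + 8) := by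
  obtain ⟨c, next, past, budget⟩ := r
  obtain ⟨table, size, cert, used, input, next₀, past₀, budget₀, aux, out⟩ := m
  simp only at hm
  subst hm
  obtain ⟨mode, q₀, q₁, q₂, q₃, lv, rv, bad⟩ := c
  by_cases h₁ : (mode == .tag && b) = true
  · simp only [Bool.and_eq_true, beq_iff_eq] at h₁
    obtain ⟨rfl, rfl⟩ := h₁
    refine ⟨none, (Runs.seq (Runs.flat _ rfl) (Runs.ite_true (by rfl)
      (Runs.seq (runs_incr (by decide) _ _ (by simp [pushCur, Prog.run, State.set]))
        (Runs.flat _ rfl)))).cast ?_ ?_⟩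
    · cases h : budget.all id <;>
        simp [pushCur, Prog.run, State.set, Eval.step, Reg.guard, h]
    · simp [pushCur, Prog.run, State.set]
      omega
  by_cases h₂ : mode.isWire = true
  swap
  · refine ⟨some b, (Runs.seq (Runs.flat _ rfl) (Runs.ite_false ?_
      (Runs.ite_false ?_ (Runs.flat _ rfl)))).cast ?_ (Nat.zero_le _)⟩
    · cases mode <;> cases b <;> simp_all [pushCur, Prog.run, State.set]
    · simpa [pushCur, Prog.run, State.set] using h₂
    · cases mode <;> cases b <;> simp_all [pushCur, Prog.run, State.set, Eval.step, Mode.isWire]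
  cases b
  swap
  · refine ⟨next.head?, (Runs.seq (Runs.flat _ rfl) (Runs.ite_false ?_
      (Runs.ite_true ?_ (Runs.ite_true ?_ (Runs.flat _ rfl))))).cast ?_ (Nat.zero_le _)⟩
    · cases mode <;> simp_all [pushCur, Prog.run, State.set]
    · simpa [pushCur, Prog.run, State.set] using h₂
    · simp [pushCur, Prog.run, State.set]
    · cases mode <;> cases next <;>
        simp_all [pushCur, popTo, Prog.run, State.set, Eval.step, Mode.isWire, Reg.guard]
  have hw : mode = .out ∨ mode = .left ∨ mode = .right := by
    cases mode <;> simp_all [Mode.isWire]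
  clear h₁ h₂
  rcases hw with rfl | rfl | rfl
  · refine ⟨next.head?, (Runs.seq (Runs.flat _ rfl) (Runs.ite_false (by rfl)
      (Runs.ite_true (by rfl) (Runs.ite_false (by rfl) (Runs.seq (Runs.flat _ rfl)
        (Runs.ite_true ?_ (Runs.flat _ rfl))))))).cast ?_ (Nat.zero_le _)⟩
    · cases next <;> simp [lookup, pushCur, popTo, Prog.run, State.set, Reg.guard]
    · cases next <;> simp [lookup, pushCur, popTo, Prog.run, State.set, Reg.guard, Eval.step]
  · refine ⟨none, (Runs.seq (Runs.flat _ rfl) (Runs.ite_false (by rfl)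
      (Runs.ite_true (by rfl) (Runs.ite_false (by rfl) (Runs.seq (Runs.flat _ rfl)
        (Runs.ite_false ?_ (Runs.ite_true ?_ (Runs.seq (Runs.flat _ rfl)
          (runs_drain (by decide) _))))))))).cast ?_ ?_⟩
    · cases next <;> simp [lookup, pushCur, popTo, Prog.run, State.set, Reg.guard]
    · cases next <;> simp [lookup, pushCur, popTo, Prog.run, State.set, Reg.guard]
    · cases next <;> simp [lookup, pushCur, popTo, Prog.run, State.set, Reg.guard, Eval.step]
    · cases next <;> simp [lookup, pushCur, popTo, Prog.run, State.set, Reg.guard] <;> omega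
  · refine ⟨none, (Runs.seq (Runs.flat _ rfl) (Runs.ite_false (by rfl)
      (Runs.ite_true (by rfl) (Runs.ite_false (by rfl) (Runs.seq (Runs.flat _ rfl)
        (Runs.ite_false ?_ (Runs.ite_false ?_ (Runs.seq (Runs.flat _ rfl)
          (Runs.seq (runs_drain (by decide) _) (Runs.seq (runs_drain (by decide) _)
            (Runs.seq (Runs.flat _ rfl) (runs_drain (by decide) _)))))))))))).cast ?_ ?_⟩
    · cases next <;> simp [lookup, pushCur, popTo, Prog.run, State.set, Reg.guard]
    · cases next <;> simp [lookup, pushCur, popTo, Prog.run, State.set, Reg.guard]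
    · cases next <;> simp [lookup, pushCur, popTo, Prog.run, State.set, Reg.guard, Eval.step]
    · cases next <;> simp [lookup, pushCur, popTo, Prog.run, State.set, Reg.guard] <;> omega

lemma foldl_pair_reverse {R : Type} (f : R → Bool → R) (l : List Bool) (r : R) (u : List Bool) :
    l.foldl (fun p b => (f p.1 b, b :: p.2)) (r, u) = (l.foldl f r, l.reverse ++ u) := by
  induction l generalizing r u with
  | nil => rfl
  | cons b l ih => simp [ih]

lemma Eval.length_step (r : Eval) (b : Bool) :
    (r.step B b).next.length + (r.step B b).past.length ≤ r.next.length + r.past.length + 1 ∧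
      (r.step B b).budget.length ≤ r.budget.length + 1 := by
  obtain ⟨⟨mode, q₀, q₁, q₂, q₃, lv, rv, bad⟩, next, past, budget⟩ := r
  cases mode <;> cases b <;> cases next <;> simp [Eval.step, length_inc_le] <;> omega

lemma Eval.length_foldl (w : List Bool) (r : Eval) :
    (w.foldl (Eval.step B) r).next.length + (w.foldl (Eval.step B) r).past.length ≤
        r.next.length + r.past.length + w.length ∧
      (w.foldl (Eval.step B) r).budget.length ≤ r.budget.length + w.length := by
  induction w generalizing r with
  | nil => simp
  | cons b w ih =>
    have h₁ := ih (r.step B b)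
    have h₂ := r.length_step (B := B) b
    simp only [List.foldl_cons, List.length_cons]
    omega

lemma runs_evalLoop (v : Reg) (m : Bank) (hm : m.aux = []) (r : Eval) (w : List Bool)
    (o : Option Bool) (M : ℕ) (h₁ : r.next.length + r.past.length + w.length ≤ M)
    (h₂ : r.budget.length + w.length ≤ M) :
    Runs (forEach .cert (evalBody B)) ((evalState v m (r, [])).set .cert w o)
      ((evalState v m (w.foldl (Eval.step B) r, w.reverse)).set .cert [] none)
      ((5 * M + 9) * w.length + 1) := by
  have := Runs.forEach (k := .cert) (p := evalBody B) (evalState v m)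
    (fun p b => (p.1.step B b, b :: p.2))
    (fun l p => p.1.next.length + p.1.past.length + l.length ≤ M ∧
      p.1.budget.length + l.length ≤ M) (5 * M + 8) (fun b l p hI => ?_) w (r, []) ⟨h₁, h₂⟩ o
  · rw [foldl_pair_reverse, List.append_nil] at this
    exact this
  · -- Each step reads a symbol and makes the lists longer by at most one entry.
    have h₂ := p.1.length_step (B := B) b
    simp only [List.length_cons] at hI
    refine ⟨⟨by dsimp only; omega, by dsimp only; omega⟩, ?_⟩
    obtain ⟨o, h⟩ := runs_evalBody (B := B) v m hm p.1 p.2 l b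
    exact ⟨o, h.mono (by omega)⟩

/-- Check the circuit on the current input, and go on to the next input. The current input and the
size bound are copied for the evaluator, and the certificate is restored after it. -/
noncomputable def tableBody (B : Set (Bool → Bool → Bool)) : Program :=
  .seq (.seq (.load fun v => { v with entry := v.cur.getD false }) <|
    .seq (drain₂ .input .aux .next) <| .seq (drain .aux .input) <|
    .seq (drain .size .aux) (drain₂ .aux .size .budget)) <|
  .seq (forEach .cert (evalBody B)) <|
  .seq (drain .used .cert) <|
  .seq (.load fun v =>
    { v with bad := v.bad || v.ctl.fails v.entry, ctl := .init, entry := false }) <|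
  .seq (clear .next) <| .seq (clear .past) <| .seq (clear .budget) (incr .input id)

/-- The memory that represents the state `p` of the fold of `tableStep`. -/
@[simp] def tableState (v : Reg) (S W : List Bool) (p : Bool × List Bool) : State :=
  state { v with ctl := .init, entry := false, bad := p.1 } { size := S, cert := W, input := p.2 }

/-- The evaluator is started once for each entry, and its `W.length` steps have linear cost. -/
lemma runs_tableBody (v : Reg) (S W X T : List Bool) (e t : Bool) (M : ℕ)
    (hM : X.length + S.length + W.length ≤ M) :
    Runs (tableBody B) ((tableState v S W (e, X)).set .table T (some t))
      ((tableState v S W (tableStep B S W (e, X) t)).set .table T none) (16 * (M + 1) ^ 2) := by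
  let v' : Reg := { v with entry := t, bad := e }
  let m : Bank := { table := T, size := S, input := X }
  have h₁ : Runs (.seq (.load fun v => { v with entry := v.cur.getD false }) <|
      .seq (drain₂ .input .aux .next) <| .seq (drain .aux .input) <|
      .seq (drain .size .aux) (drain₂ .aux .size .budget))
      ((tableState v S W (e, X)).set .table T (some t))
      ((evalState v' m (Eval.init X.reverse S, [])).set .cert W none)
      (2 * X.length + 2 * S.length + 4) := by
    refine (Runs.seq (Runs.flat _ rfl) (Runs.seq
      (runs_drain₂ (by decide) (by decide) (by decide) _) (Runs.seq (runs_drain (by decide) _)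
      (Runs.seq (runs_drain (by decide) _)
        (runs_drain₂ (by decide) (by decide) (by decide) _))))).cast ?_ ?_
    · simp [Prog.run, State.set, Eval.init, v', m]
    · simp [Prog.run, State.set]
      omega
  have h₂ := runs_evalLoop (B := B) v' m rfl (Eval.init X.reverse S) W none M
    (by simp [Eval.init]; omega) (by simp [Eval.init]; omega)
  have hr := Eval.length_foldl (B := B) W (Eval.init X.reverse S)
  rw [← evalRow] at h₂ hr
  simp only [Eval.init, List.length_reverse, List.length_nil] at hr
  have h₃ : (5 * M + 9) * W.length ≤ (5 * M + 9) * M := Nat.mul_le_mul_left _ (by omega)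
  refine (Runs.seq h₁ (Runs.seq h₂ (Runs.seq (runs_drain (by decide) _)
    (Runs.seq (Runs.flat _ rfl) (Runs.seq (runs_clear _ _) (Runs.seq (runs_clear _ _)
      (Runs.seq (runs_clear _ _) (runs_incr (by decide) _ _ ?_)))))))).cast ?_ ?_
  · simp [Prog.run, State.set, m]
  · simp [Prog.run, State.set, m, v', tableStep]
  · simp [Prog.run, State.set, m]
    nlinarith

lemma runs_tableLoop (v : Reg) (S W X T : List Bool) (e : Bool) (o : Option Bool) (M : ℕ)
    (hM : X.length + T.length + S.length + W.length ≤ M) :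
    Runs (forEach .table (tableBody B)) ((tableState v S W (e, X)).set .table T o)
      ((tableState v S W (T.foldl (tableStep B S W) (e, X))).set .table [] none)
      ((16 * (M + 1) ^ 2 + 1) * T.length + 1) := by
  refine Runs.forEach (k := .table) (p := tableBody B) (tableState v S W) (tableStep B S W)
    (fun l p => p.2.length + l.length + S.length + W.length ≤ M) _ (fun b l p hI => ?_) T (e, X)
    (by simpa using hM) o
  have := length_inc_le p.2
  simp only [List.length_cons] at hI
  refine ⟨by simp only [tableStep]; omega, none, ?_⟩
  exact runs_tableBody v S W p.2 l p.1 b M (by omega)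

/-- One step of the parser, with the reversed lists on the stacks `past`, `next` and `used`. -/
def parseBody : Program :=
  .seq (.ite (fun v => decide (v.sec = .bit) && v.sym.join.isSome)
    (.push .past fun v => v.sym.join.getD false) (.load id)) <|
  .seq (.ite (fun v => decide (v.sec = .num) && v.sym.join.isSome)
    (.push .next fun v => !v.sym.join.getD false) (.load id)) <|
  .seq (.ite (fun v => decide (v.sec = .cert) && v.sym.join.isSome)
    (.push .used fun v => v.sym.join.getD false) (.load id)) <|
  .load fun v =>
    let p := Parse.step ⟨v.sec, v.last, v.bad, [], [], []⟩ v.sym.join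
    { v with sec := p.mode, last := p.last, bad := p.bad }

/-- Read and parse the input. -/
def readInput : Program :=
  .seq (.read fun v a => { v with sym := a }) <|
    .loop (fun v => v.sym.isSome) (.seq parseBody (.read fun v a => { v with sym := a }))

/-- The register at the start. -/
def Reg.init : Reg := ⟨.init, .tag, true, false, false, false, none, none⟩

/-- The memory that represents the state `p` of the parser, with the remaining input `l`. -/
@[simp] def parseState (p : Parse) (a : Option (Option Bool)) (l : List (Option Bool)) : State :=
  ⟨{ Reg.init with sec := p.mode, last := p.last, bad := p.bad, sym := a }, l,
    Bank.get { past := p.table, next := p.size, used := p.cert }⟩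

/-- The lists of `Parse.step` are only extended, so its effect on the stacks and on the control does
not depend on their contents. -/
lemma runs_readInput (l : List (Option Bool)) (p : Parse) :
    Runs readInput (parseState p none l) (parseState (l.foldl Parse.step p) none [])
      (l.length + 1) := by
  refine (Runs.seq (t := 0) (t' := l.length + 1) (s' := parseState p l.head? l.tail)
    (Runs.of_flat rfl rfl) ?_).mono (by omega)
  induction l generalizing p with
  | nil => exact (Runs.loop_done rfl).mono (by simp)
  | cons a l ih =>
    refine (Runs.loop_next (t := 0) (by rfl) (Runs.of_flat rfl ?_) (ih (p.step a))).mono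
      (by simp)
    obtain ⟨mode, last, bad, T, S, W⟩ := p
    cases mode <;> rcases a with _ | _ | _ <;> simp [parseBody, Prog.run, Parse.step]

/-- The program of the verifier. The input is parsed, the reversed lists of the parser are brought
into order while the entries of the truth table are counted, the count is compared with the powers
of two, which leaves the first input of the circuit, and the entries are checked one by one. At the
end only the answer is left on the stacks. -/
noncomputable def verifier (B : Set (Bool → Bool → Bool)) : Program :=
  .seq readInput <|
  .seq (forEach .past (.seq (pushCur .table) (incr .budget id))) <|
  .seq (.seq (drain .next .size) (drain .used .cert)) <|
  .seq (forEach .budget (.seq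
    (.ite (fun v => v.cur == some true) (.load id) (.push .input fun _ => false))
    (.load fun v => { v with seen := v.seen || v.cur.getD false, bad := v.bad || v.seen }))) <|
  .seq (.load fun v => { v with bad := v.bad || !v.seen }) <|
  .seq (forEach .table (tableBody B)) <|
  .seq (clear .size) <| .seq (clear .cert) <| .seq (clear .input) <|
  .seq (.push .out fun v => !v.bad) (.load fun _ => .init)

lemma foldl_inc (l z : List Bool) (d : List Bool) :
    l.foldl (fun p b => (b :: p.1, inc p.2)) (z, d) = (l.reverse ++ z, inc^[l.length] d) := by
  induction l generalizing z d with
  | nil => rfl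
  | cons b l ih => simp [ih]

lemma length_iterate_inc (i : ℕ) (d : List Bool) : (inc^[i] d).length ≤ d.length + i := by
  induction i generalizing d with
  | zero => simp
  | succ i ih =>
    have := ih (inc d)
    have := length_inc_le d
    rw [Function.iterate_succ_apply]
    omega

/-- The truth table is brought into order, and its entries are counted in binary. -/
lemma runs_count (v : Reg) (S W T : List Bool) :
    Runs (forEach .past (.seq (pushCur .table) (incr .budget id)))
      (state v { past := T, next := S, used := W })
      (state { v with cur := none }
        { table := T.reverse, budget := inc^[T.length] [], next := S, used := W })
      ((2 * T.length + 3) * T.length + 1) := by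
  have := Runs.forEach (k := .past) (p := .seq (pushCur .table) (incr .budget id))
    (fun p : List Bool × List Bool =>
      state v { table := p.1, budget := p.2, next := S, used := W })
    (fun p b => (b :: p.1, inc p.2))
    (fun l p => p.2.length + l.length ≤ T.length) (2 * T.length + 2) (fun b l p hI => ?_)
    T ([], []) (by simp) v.cur
  · rw [foldl_inc] at this
    simpa [State.set] using this
  · have := length_inc_le p.2
    simp only [List.length_cons] at hI
    refine ⟨by dsimp only; omega, none, (Runs.seq (Runs.flat _ rfl)
      (runs_incr (by decide) _ _ (by simp [pushCur, Prog.run, State.set]))).cast ?_ ?_⟩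
    · simp [pushCur, Prog.run, State.set]
    · simp [pushCur, Prog.run, State.set]
      omega

/-- The comparison of the counter `d` with the powers of two. -/
lemma runs_pow (v : Reg) (T S W d : List Bool) :
    Runs (forEach .budget (.seq
      (.ite (fun v => v.cur == some true) (.load id) (.push .input fun _ => false))
      (.load fun v => { v with seen := v.seen || v.cur.getD false, bad := v.bad || v.seen })))
      (state v { table := T, size := S, cert := W, budget := d })
      (state { v with
          seen := (d.foldl powStep (v.seen, v.bad, [])).1
          bad := (d.foldl powStep (v.seen, v.bad, [])).2.1
          cur := none }
        { table := T, size := S, cert := W, input := (d.foldl powStep (v.seen, v.bad, [])).2.2 })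
      (d.length + 1) := by
  have := Runs.forEach (k := .budget) (p := .seq
      (.ite (fun v => v.cur == some true) (.load id) (.push .input fun _ => false))
      (.load fun v => { v with seen := v.seen || v.cur.getD false, bad := v.bad || v.seen }))
    (fun p : Bool × Bool × List Bool => state { v with seen := p.1, bad := p.2.1 }
      { table := T, size := S, cert := W, input := p.2.2 }) powStep
    (fun _ _ => True) 0 (fun b l p _ => ⟨trivial, some b, Runs.of_flat rfl ?_⟩)
    d (v.seen, v.bad, []) trivial v.cur
  · simpa [State.set] using this
  · cases b <;> simp [Prog.run, State.set, powStep]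

/-- The main contribution to the cost: at most `L` entries of the truth table, for each of them the
at most `L` symbols of the certificate, and for each of these a number of loop tests linear in
`L`. -/
lemma runs_verifier (x w : List Bool) :
    Runs (verifier B) ⟨.init, encodePair (x, w), fun _ => []⟩
      ⟨.init, [], Function.update (fun _ => []) .out [!rejects B (parse x w)]⟩
      (1000 * ((encodePair (x, w)).length + 1) ^ 3) := by
  have hlen := length_parse (encodePair (x, w)) .init
  have hread := runs_readInput (encodePair (x, w)) .init
  rw [← parse] at hlen hread
  generalize hL : (encodePair (x, w)).length = L at *
  generalize hp : parse x w = p at *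
  simp only [Parse.init, List.length_nil] at hlen
  have hbank : (fun _ : Store => ([] : List Bool)) = Bank.get {} := by
    funext k; cases k <;> rfl
  have hpow : (powTest p).2.2.length ≤ L := by
    have h₁ := length_foldl_powStep (inc^[p.table.length] []) (false, p.bad, [])
    have h₂ := length_iterate_inc p.table.length []
    simp only [List.length_nil] at h₁ h₂
    rw [powTest]
    omega
  have hd := length_iterate_inc p.table.length []
  let v : Reg := { Reg.init with sec := p.mode, last := p.last, bad := p.bad }
  let v' : Reg := { v with seen := (powTest p).1 }
  have hcount := runs_count v p.size p.cert p.table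
  have hdrain : Runs (.seq (drain .next .size) (drain .used .cert))
      (state v { table := p.table.reverse, budget := inc^[p.table.length] [],
                 next := p.size, used := p.cert })
      (state v { table := p.table.reverse, budget := inc^[p.table.length] [],
                 size := p.size.reverse, cert := p.cert.reverse })
      (p.size.length + p.cert.length + 2) := by
    refine (Runs.seq (runs_drain (by decide) _) (runs_drain (by decide) _)).cast ?_ ?_
    · simp [v, Reg.init]
    · simp
      omega
  have htest := runs_pow v p.table.reverse p.size.reverse p.cert.reverse
    (inc^[p.table.length] [])
  rw [show List.foldl powStep (v.seen, v.bad, []) (inc^[p.table.length] []) = powTest p from rfl]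
    at htest
  have htable := runs_tableLoop (B := B) v' p.size.reverse p.cert.reverse (powTest p).2.2
    p.table.reverse ((powTest p).2.1 || !(powTest p).1) none (2 * L) (by simp; omega)
  have hload : Runs (.load fun v => { v with bad := v.bad || !v.seen } : Program)
      (state { v with seen := (powTest p).1, bad := (powTest p).2.1, cur := none }
        { table := p.table.reverse, size := p.size.reverse, cert := p.cert.reverse,
          input := (powTest p).2.2 })
      ((tableState v' p.size.reverse p.cert.reverse
        ((powTest p).2.1 || !(powTest p).1, (powTest p).2.2)).set .table p.table.reverse none)
      0 := by
    refine Runs.of_flat rfl ?_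
    simp [Prog.run, State.set, v', v, Reg.init]
  have hX : (p.table.reverse.foldl (tableStep B p.size.reverse p.cert.reverse)
      ((powTest p).2.1 || !(powTest p).1, (powTest p).2.2)).2.length ≤ 2 * L := by
    have h (T : List Bool) (q : Bool × List Bool) :
        (T.foldl (tableStep B p.size.reverse p.cert.reverse) q).2 = inc^[T.length] q.2 := by
      induction T generalizing q with
      | nil => rfl
      | cons t T ih => simp [ih, tableStep]
    rw [h, List.length_reverse]
    have := length_iterate_inc p.table.length (powTest p).2.2
    dsimp only
    omega
  rw [hbank]
  refine (Runs.seq hread (Runs.seq hcount (Runs.seq hdrain (Runs.seq htest (Runs.seq hload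
    (Runs.seq htable (Runs.seq (runs_clear _ _) (Runs.seq (runs_clear _ _)
      (Runs.seq (runs_clear _ _) (Runs.flat _ rfl)))))))))).cast ?_ ?_
  · simp [Prog.run, State.set, rejects]
  · simp only [List.length_nil, List.length_reverse, zero_add] at hd hX ⊢
    have h₁ : (16 * (2 * L + 1) ^ 2 + 1) * p.table.length ≤ (16 * (2 * L + 1) ^ 2 + 1) * L :=
      Nat.mul_le_mul_left _ (by omega)
    have h₂ : (2 * p.table.length + 3) * p.table.length ≤ (2 * L + 3) * L :=
      Nat.mul_le_mul (by omega) (by omega)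
    simp [State.set, -List.foldl_reverse]
    ring_nf at h₁ h₂ ⊢
    omega

open Classical in
/-- Circuits as certificates are verified in polynomial time. -/
theorem polyTimeDecidable_circuitCertifies (B : Set (Bool → Bool → Bool)) :
    PolyTimeDecidable (CircuitCertifies B) := by
  refine (verifier B).computableInPolyTime .out .init encodePair Computability.encodeBool _
    (1000 * (Polynomial.X + 1) ^ 3) fun a => ?_
  refine (runs_verifier (B := B) a.1 a.2).cast ?_ (by simp)
  have : decide (CircuitCertifies B a.1 a.2) = !rejects B (parse a.1 a.2) := by
    rw [← rejects_parse_eq_false_iff]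
    cases rejects B (parse a.1 a.2) <;> simp
  rw [this]
  rfl

/-! ### An upper bound for the size of circuits -/

/-- Some wire of the gate list `gs` computes the function `f`. -/
def HasWire (n : ℕ) (gs : List Gate) (f : (Fin n → Bool) → Bool) : Prop :=
  ∃ o < n + gs.length, ∀ x, (wiresOf gs (List.ofFn x)).getD o false = f x

lemma wiresOf_append (gs hs : List Gate) (v : List Bool) :
    wiresOf (gs ++ hs) v = wiresOf hs (wiresOf gs v) := by
  simp [wiresOf]

lemma prefix_wiresOf (gs : List Gate) (v : List Bool) : v <+: wiresOf gs v := by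
  induction gs using List.reverseRecOn with
  | nil => exact List.prefix_rfl
  | append_singleton gs g ih =>
    rw [wiresOf_concat]
    exact ih.trans (List.prefix_append _ _)

lemma getD_wiresOf (gs : List Gate) {v : List Bool} {i : ℕ} (hi : i < v.length) :
    (wiresOf gs v).getD i false = v.getD i false := by
  obtain ⟨u, hu⟩ := prefix_wiresOf gs v
  rw [← hu, List.getD_append _ _ _ _ hi]

lemma HasWire.append {gs : List Gate} {f : (Fin n → Bool) → Bool} (h : HasWire n gs f)
    (hs : List Gate) : HasWire n (gs ++ hs) f := by
  obtain ⟨o, ho, h⟩ := h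
  refine ⟨o, by simp; omega, fun x => ?_⟩
  rw [wiresOf_append, getD_wiresOf _ (by simpa [length_wiresOf] using ho), h]

lemma hasWire_input (gs : List Gate) (i : Fin n) : HasWire n gs fun x => x i := by
  refine ⟨i, by omega, fun x => ?_⟩
  rw [getD_wiresOf _ (by simp)]
  simp [List.getD_eq_getElem?_getD]

/-- The wire of a longer gate list that plays the role of wire `i` of a circuit with two inputs,
if the inputs are fed from the wires `a` and `b` and its gates are appended at wire `N`. -/
def reroute (a b N i : ℕ) : ℕ := if i = 0 then a else if i = 1 then b else N + (i - 2)

/-- A gate with its wires rerouted. -/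
def Gate.reroute (a b N : ℕ) (g : Gate) : Gate :=
  ⟨g.op, MinCircuit.reroute a b N g.left, MinCircuit.reroute a b N g.right⟩

/-- Two wires of a gate list can be fed into a circuit with two inputs. -/
lemma reroute_circuit {gs : List Gate} (hgs : ValidGates B n gs) {a b : ℕ}
    (ha : a < n + gs.length) (hb : b < n + gs.length) (hs : List Gate) (hh : ValidGates B 2 hs) :
    ValidGates B n (gs ++ hs.map (Gate.reroute a b (n + gs.length))) ∧
    ∀ x : Fin n → Bool, ∀ i < 2 + hs.length,
      (wiresOf (gs ++ hs.map (Gate.reroute a b (n + gs.length))) (List.ofFn x)).getD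
          (reroute a b (n + gs.length) i) false =
        (wiresOf hs [(wiresOf gs (List.ofFn x)).getD a false,
          (wiresOf gs (List.ofFn x)).getD b false]).getD i false := by
  have hlt (k i : ℕ) (hi : i < 2 + k) : reroute a b (n + gs.length) i < n + gs.length + k := by
    unfold reroute
    split_ifs <;> omega
  induction hs using List.reverseRecOn with
  | nil =>
    refine ⟨by simpa using hgs, fun x i hi => ?_⟩
    obtain rfl | rfl : i = 0 ∨ i = 1 := by simp at hi; omega
    · simp [reroute, wiresOf]
    · simp [reroute, wiresOf]
  | append_singleton hs g ih =>
    rw [validGates_concat] at hh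
    obtain ⟨hh, hop, hl, hr⟩ := hh
    obtain ⟨ih₁, ih₂⟩ := ih hh
    rw [List.map_append, List.map_singleton, ← List.append_assoc]
    refine ⟨validGates_concat.2 ⟨ih₁, hop, ?_, ?_⟩, fun x i hi => ?_⟩
    · have := hlt _ _ hl
      simp [Gate.reroute]; omega
    · have := hlt _ _ hr
      simp [Gate.reroute]; omega
    · rw [wiresOf_concat, wiresOf_concat]
      by_cases hi' : i < 2 + hs.length
      · have := hlt _ _ hi'
        rw [List.getD_append _ _ _ _ (by simp [length_wiresOf]; omega),
          List.getD_append _ _ _ _ (by simpa [length_wiresOf, add_comm] using hi'), ih₂ x i hi']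
      · obtain rfl : i = 2 + hs.length := by simp at hi; omega
        have h₁ : reroute a b (n + gs.length) (2 + hs.length) = n + gs.length + hs.length := by
          unfold reroute
          split_ifs <;> omega
        rw [h₁, List.getD_append_right _ _ _ _ (by simp [length_wiresOf]; omega),
          List.getD_append_right _ _ _ _ (by simp [length_wiresOf])]
        simp only [Gate.reroute, ih₂ x _ hl, ih₂ x _ hr]
        simp [length_wiresOf, add_assoc]

/-- Any binary operation, applied to functions that are computed by wires of a gate list over `B`,
can be computed with at most `c` more gates. -/
def BinaryCost (B : Set (Bool → Bool → Bool)) (c : ℕ) : Prop :=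
  ∀ (n : ℕ) (gs : List Gate), ValidGates B n gs → ∀ f g : (Fin n → Bool) → Bool,
    HasWire n gs f → HasWire n gs g → ∀ h : Bool → Bool → Bool,
    ∃ hs : List Gate, hs.length ≤ c ∧ ValidGates B n (gs ++ hs) ∧
      HasWire n (gs ++ hs) fun x => h (f x) (g x)

/-- There are only finitely many binary operations, and functional completeness gives a circuit with
two inputs for each of them. -/
lemma exists_binary_cost (hB : FunctionallyComplete B) : ∃ c : ℕ, BinaryCost B c := by
  choose C hC using fun h : Bool → Bool → Bool => hB 2 (by norm_num) fun y => h (y 0) (y 1)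
  refine ⟨Finset.univ.sup fun h => (C h).size, fun n gs hgs f g hf hg h => ?_⟩
  obtain ⟨a, ha, hf⟩ := hf
  obtain ⟨b, hb, hg⟩ := hg
  obtain ⟨h₁, h₂⟩ := reroute_circuit hgs ha hb (C h).gates (C h).validGates
  refine ⟨(C h).gates.map (Gate.reroute a b (n + gs.length)), ?_, h₁,
    reroute a b (n + gs.length) (C h).out, ?_, fun x => ?_⟩
  · rw [List.length_map]
    exact Finset.le_sup (f := fun h => (C h).size) (Finset.mem_univ h)
  · have := (C h).out_lt
    unfold reroute
    simp only [List.length_append, List.length_map]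
    split_ifs <;> omega
  · rw [h₂ x _ (C h).out_lt, hf, hg]
    have := congrFun (hC h) ![f x, g x]
    rw [Circuit.eval_eq] at this
    simpa using this

/-- The conjunction of literals that holds at the points which agree with `p` on the coordinates
`js` costs at most `c` gates for each coordinate and for the constant `true` to start with. The
constant is computed from the input `i₀`, as without inputs there would be no circuits at all. -/
lemma exists_agree {c : ℕ} (hc : BinaryCost B c) (i₀ : Fin n) (p : Fin n → Bool)
    (gs : List Gate) (hgs : ValidGates B n gs) (js : List (Fin n)) :
    ∃ hs : List Gate, hs.length ≤ c * (js.length + 1) ∧ ValidGates B n (gs ++ hs) ∧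
      HasWire n (gs ++ hs) fun x => js.all fun j => x j == p j := by
  induction js with
  | nil =>
    obtain ⟨hs, h₁, h₂, h₃⟩ := hc n gs hgs _ _ (hasWire_input gs i₀) (hasWire_input gs i₀)
      fun _ _ => true
    exact ⟨hs, by simpa using h₁, h₂, h₃⟩
  | cons j js ih =>
    obtain ⟨hs, h₁, h₂, h₃⟩ := ih
    -- A literal needs no gate of its own: its sign is part of the operation that appends it.
    obtain ⟨hs', h₁', h₂', h₃'⟩ := hc n _ h₂ _ _ (hasWire_input _ j) h₃ fun a b => (a == p j) && b
    refine ⟨hs ++ hs', ?_, by rwa [← List.append_assoc], ?_⟩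
    · simp only [List.length_append, List.length_cons]
      calc hs.length + hs'.length ≤ c * (js.length + 1) + c := add_le_add h₁ h₁'
        _ = _ := by ring
    · rw [← List.append_assoc]
      exact h₃'

/-- The disjunctive normal form of `f`, restricted to the points in `ps`. A point costs at most
`n + 2` operations: `n + 1` for the test of agreement, and one to append it. -/
lemma exists_restrict {c : ℕ} (hc : BinaryCost B c) (i₀ : Fin n)
    (f : (Fin n → Bool) → Bool) (ps : List (Fin n → Bool)) :
    ∃ gs : List Gate, gs.length ≤ c * ((n + 2) * ps.length + 1) ∧ ValidGates B n gs ∧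
      HasWire n gs fun x => decide (x ∈ ps) && f x := by
  induction ps with
  | nil =>
    obtain ⟨hs, h₁, h₂, h₃⟩ := hc n [] .nil _ _ (hasWire_input [] i₀) (hasWire_input [] i₀)
      fun _ _ => false
    exact ⟨hs, by simpa using h₁, h₂, by simpa using h₃⟩
  | cons p ps ih =>
    obtain ⟨gs, h₁, h₂, h₃⟩ := ih
    obtain ⟨hs, h₁', h₂', h₃'⟩ := exists_agree hc i₀ p gs h₂ (List.finRange n)
    obtain ⟨hs', h₁'', h₂'', h₃''⟩ := hc n _ h₂' _ _ (h₃.append hs) h₃' fun a b => a || (b && f p)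
    refine ⟨gs ++ hs ++ hs', ?_, h₂'', ?_⟩
    · simp only [List.length_append, List.length_cons, List.length_finRange] at h₁' ⊢
      calc gs.length + hs.length + hs'.length
          ≤ c * ((n + 2) * ps.length + 1) + c * (n + 1) + c :=
            add_le_add (add_le_add h₁ h₁') h₁''
        _ = _ := by ring
    · convert h₃'' using 2 with x
      have h : ((List.finRange n).all fun j => x j == p j) = decide (x = p) := by
        rw [Bool.eq_iff_iff]
        simp [funext_iff]
      rw [h]
      by_cases hx : x = p
      · subst hx; cases f x <;> simp
      · simp [hx]

/-- Over a functionally complete basis, all functions of `n` variables have circuits of size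
`O(n 2 ^ n)`. -/
theorem exists_circuit_size_le (hB : FunctionallyComplete B) :
    ∃ c : ℕ, ∀ (n : ℕ), 1 ≤ n → ∀ f : (Fin n → Bool) → Bool,
      ∃ C : Circuit B n, C.eval = f ∧ C.size ≤ c * ((n + 2) * 2 ^ n + 1) := by
  obtain ⟨c, hc⟩ := exists_binary_cost hB
  refine ⟨c, fun n hn f => ?_⟩
  obtain ⟨gs, h₁, h₂, o, ho, h₃⟩ := exists_restrict hc ⟨0, hn⟩ f Finset.univ.toList
  refine ⟨⟨gs, o, h₂.op_mem, h₂.left_lt, h₂.right_lt, ho⟩, ?_, ?_⟩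
  · funext x
    rw [Circuit.eval_eq, h₃]
    simp
  · simpa [Circuit.size] using h₁

/-- The code of a circuit has polynomial length. -/
lemma Circuit.length_encode_le (C : Circuit B n) :
    C.encode.length ≤ (C.size + 1) * (2 * (n + C.size) + 7) := by
  have h (gs : List Gate) (m : ℕ) (hg : ∀ g ∈ gs, g.left < m ∧ g.right < m) :
      (gs.flatMap Gate.encode).length ≤ gs.length * (2 * m + 7) := by
    induction gs with
    | nil => simp
    | cons g gs ih =>
      have h₁ := ih fun g hg' => hg g (by simp [hg'])
      have h₂ := hg g (by simp)
      simp only [List.flatMap_cons, List.length_append, List.length_cons, Gate.encode, unary,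
        List.length_replicate, List.length_nil, add_mul, one_mul] at h₁ ⊢
      omega
  have hw (g : Gate) (hg : g ∈ C.gates) : g.left < n + C.size ∧ g.right < n + C.size := by
    obtain ⟨k, hk, rfl⟩ := List.getElem_of_mem hg
    have h₁ := C.left_lt k hk
    have h₂ := C.right_lt k hk
    simp only [Circuit.size]
    omega
  have h₁ := h C.gates _ hw
  have h₂ := C.out_lt
  simp only [Circuit.encode, List.length_append, List.length_cons, unary, List.length_replicate,
    List.length_nil, add_mul, one_mul, Circuit.size] at h₁ ⊢
  omega

lemma eq_of_encodeInstance_eq {T T' : List Bool} {s s' : ℕ}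
    (h : encodeInstance T s = encodeInstance T' s') : T = T' := by
  have h₁ := parse_encodeInstance T s []
  rw [h, parse_encodeInstance] at h₁
  simpa using (congrArg Parse.table h₁).symm

lemma length_le_length_encodeInstance (T : List Bool) (s : ℕ) :
    T.length ≤ (encodeInstance T s).length := by
  simp [encodeInstance]
  omega

/-- Over a functionally complete basis, the members of the circuit size problem have certificates
whose length is polynomial in the length of the truth table, however large the size bound is. -/
theorem exists_short_certificate (hB : FunctionallyComplete B) :
    ∃ p : Polynomial ℕ, Monotone (fun k => p.eval k) ∧ ∀ (T : List Bool) (s : ℕ),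
      encodeInstance T s ∈ MCSP B →
        ∃ w : List Bool, w.length ≤ p.eval T.length ∧
          CircuitCertifies B (encodeInstance T s) w := by
  obtain ⟨c, hc⟩ := exists_circuit_size_le hB
  let q (k : ℕ) : ℕ := c * ((k + 2) * k + 1)
  let P : Polynomial ℕ := Polynomial.C c * ((Polynomial.X + 2) * Polynomial.X + 1)
  have hP (k : ℕ) : P.eval k = q k := by simp [P, q]
  have hq : Monotone q := fun a b hab => by dsimp only [q]; gcongr
  refine ⟨(P + 1) * (2 * (Polynomial.X + P) + 7), ?_, fun T s h => ?_⟩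
  · intro a b hab
    have := hq hab
    simp only [Polynomial.eval_mul, Polynomial.eval_add, hP, Polynomial.eval_X,
      Polynomial.eval_one, Polynomial.eval_ofNat]
    gcongr
  · obtain ⟨T', s', hTs, n, C, hs, hC⟩ := h
    have hn : 1 ≤ n := by
      -- Without inputs there is no wire that the first gate, or the output, could name.
      by_contra hn
      obtain rfl : n = 0 := by omega
      have hout := C.out_lt
      by_cases hg : C.gates.length = 0
      · omega
      · have := C.left_lt 0 (by omega)
        omega
    obtain ⟨C', hC', hsize⟩ := hc n hn C.eval
    obtain ⟨D, hD, hDs, hDc⟩ : ∃ D : Circuit B n, D.eval = C.eval ∧ D.size ≤ s' ∧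
        D.size ≤ c * ((n + 2) * 2 ^ n + 1) := by
      by_cases h : C'.size ≤ s'
      · exact ⟨C', hC', h, hsize⟩
      · exact ⟨C, rfl, hs, by omega⟩
    refine ⟨D.encode, ?_, T', s', hTs, n, D, rfl, hDs, by rw [hD, hC]⟩
    have hT : T.length = 2 ^ n := by
      rw [eq_of_encodeInstance_eq hTs, ← hC]
      simp [truthTable]
    have hnT : n ≤ T.length := hT ▸ Nat.lt_two_pow_self.le
    have hDq : D.size ≤ q T.length := by
      refine hDc.trans ?_
      rw [← hT]
      dsimp only [q]
      gcongr
    refine D.length_encode_le.trans ?_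
    simp only [Polynomial.eval_mul, Polynomial.eval_add, hP, Polynomial.eval_X,
      Polynomial.eval_one, Polynomial.eval_ofNat]
    gcongr

end MinCircuit

theorem mainTheorem2 (B : Set (Bool → Bool → Bool)) (hB : MinCircuit.FunctionallyComplete B) :
    MinCircuit.MCSP B ∈ MinCircuit.NP ∧
    MinCircuit.IsPolyTimeVerifier (MinCircuit.CircuitCertifies B) (MinCircuit.MCSP B) ∧
    ∃ p : Polynomial ℕ, ∀ (T : List Bool) (s : ℕ),
      MinCircuit.encodeInstance T s ∈ MinCircuit.MCSP B →
        ∃ w : List Bool, w.length ≤ p.eval T.length ∧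
          MinCircuit.CircuitCertifies B (MinCircuit.encodeInstance T s) w := by
  obtain ⟨p, hmono, hp⟩ := MinCircuit.exists_short_certificate hB
  have hver : MinCircuit.IsPolyTimeVerifier (MinCircuit.CircuitCertifies B)
      (MinCircuit.MCSP B) := by
    refine ⟨MinCircuit.polyTimeDecidable_circuitCertifies B, p, fun x => ⟨fun hx => ?_, ?_⟩⟩
    · obtain ⟨T, s, rfl, h⟩ := id hx
      obtain ⟨w, hw, hTw⟩ := hp T s hx
      exact ⟨w, hw.trans (hmono (MinCircuit.length_le_length_encodeInstance T s)), hTw⟩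
    · rintro ⟨w, -, T, s, hx, n, C, -, hs, hC⟩
      exact ⟨T, s, hx, n, C, hs, hC⟩
  exact ⟨⟨_, hver⟩, hver, p, hp⟩
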